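/- For $f\in L^2(\mathbb R)$ (complex valued) let $$\mathcal G f(x,y)=\int_{\mathbb R} f(t)\,e^{-\pi(t-x)^2}e^{-2\pi i t y}\,dt,\qquad (x,y)\in\mathbb R^2,$$ be its Gabor transform and $\mathcal S f=|\mathcal G f|^2$ its spectrogram. Let $f\in L^2(\mathbb R)$, let $\mathcal Q$ be a finite family of $\nu=|\mathcal Q|$ closed squares of side length $1$ in $\mathbb R^2$ (with arbitrary centres and orientations), and set $\Omega=\bigcup_{Q\in\mathcal Q}Q$. Associate with $(f,\mathcal Q)$ the weighted graph whose vertices are the members of $\mathcal Q$, with vertex weights $w(Q)=\|\mathcal S f\|_{L^1(Q)}$ and edge weights $\sigma(Q,Q')=\|\mathcal S f\|_{L^1(Q\cap Q')}^2$ for all $Q,Q'\in\mathcal Q$. Let $\Lambda=D-A$ be its graph Laplacian, where $A(Q,Q')=\sigma(Q,Q')$ and $D$ is the diagonal matrix with entries $D(Q,Q)=\sum_{Q'}\sigma(Q,Q')$, and let $$\lambda=\inf\left\{\frac{\mathbf z^*\Lambda\,\mathbf z}{\sum_{Q}|z_Q|^2w(Q)}\;:\;\mathbf z\in\mathbb C^{\mathcal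 Q},\ \mathbf z\ne 0,\ \sum_{Q}z_Q\,w(Q)=0\right\}\in[0,\infty]$$ be its algebraic connectivity, where $\inf\emptyset=\infty$ and $0/0=0$. For $g\in L^2(\mathbb R)$ put $$M=\sum_{Q\in\mathcal Q}\|\mathcal S f\|_{L^1(Q)}^{-2},\qquad L=\Big\|\sum_{Q\in\mathcal Q}\mathbb 1_Q\Big\|_{L^\infty(\mathbb R^2)},\qquad K=\|\mathcal S f\|_{L^\infty(\mathbb R^2)}+\|\mathcal S g\|_{L^\infty(\mathbb R^2)}.$$ Then there exists a universal constant $C>0$, independent of $f$, $g$ and $\mathcal Q$, such that for all $g\in L^2(\mathbb R)$ $$\min_{|\tau|=1}\|\mathcal G g-\tau\,\mathcal G f\|_{L^2(\Omega)}\le C\left(KM^{1/2}L^{1/2}+\lambda^{-1}K\nu^{3/2}L^{1/2}+\operatorname{vol}(\Omega)^{1/2}\right)^{1/2}\|\mathcal S f-\mathcal S g\|_{L^2(\Omega)}^{1/2},$$ where the minimum is attained, and the right-hand side is computed in $[0,\infty]$ with $0^{-1}=\infty$, $\infty^{-1}=0$ and $0\cdot\infty=0$. -/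

import Mathlib

open MeasureTheory
open scoped ENNReal NNReal FourierTransform

noncomputable section

namespace GaborStability

/-- The Gabor transform of `f`, as a function on the plane `ℂ ≃ ℝ²`, `z = x + i y`:
the Fourier transform (normalised with the kernel `exp (-2 π i t y)`) of
`t ↦ f t * exp (-π (t - x)²)`, evaluated at the frequency `y`. -/
def gabor (f : ℝ → ℂ) (z : ℂ) : ℂ :=
  𝓕 (fun t : ℝ => f t * ((Real.exp (-Real.pi * (t - z.re) ^ 2) : ℝ) : ℂ)) z.im

/-- The spectrogram, i.e. the squared modulus of the Gabor transform. -/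
def spectrogram (f : ℝ → ℂ) (z : ℂ) : ℝ := ‖gabor f z‖ ^ 2

/-- `Q` is a (closed) square of side length `1` in the plane, with arbitrary centre `z₀` and
arbitrary orientation `u`. -/
def IsUnitSquare (Q : Set ℂ) : Prop :=
  ∃ (z₀ : ℂ) (u : Circle),
    Q = (fun z : ℂ => z₀ + (u : ℂ) * z) ''
      (Set.Icc (-1 / 2 : ℝ) (1 / 2) ×ℂ Set.Icc (-1 / 2 : ℝ) (1 / 2))

/-- A weighted (undirected) graph on the vertex set `V`: vertex weights `w` and edge weights `σ`.
The edge weights are extended by zero to all pairs of vertices. -/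
structure WeightedGraph (V : Type*) where
  w : V → ℝ≥0
  σ : V → V → ℝ≥0
  symm : ∀ u v, σ u v = σ v u

namespace WeightedGraph

variable {V : Type*} [Fintype V] [DecidableEq V]

/-- The adjacency matrix `A(u, v) = σ(u, v)`. -/
def adjacency (G : WeightedGraph V) : Matrix V V ℝ :=
  Matrix.of fun u v => (G.σ u v : ℝ)

/-- The degree of a vertex. -/
def degree (G : WeightedGraph V) (v : V) : ℝ := ∑ u, G.adjacency u v

/-- The graph Laplacian `D - A`. -/
def laplacian (G : WeightedGraph V) : Matrix V V ℝ :=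
  Matrix.diagonal G.degree - G.adjacency

/-- The algebraic connectivity: the infimum of the Rayleigh quotients `z* L z / ‖z‖²_{ℓ²(V, w)}`
over all complex vectors `z ≠ 0` that are orthogonal to the constant vector `1` in `ℓ²(V, w)`.
It takes values in `[0, ∞]`; the infimum of the empty set (e.g. for a graph with a single vertex of
positive weight) is `∞`. The quadratic form `z* L z` is real and nonnegative by the symmetry
of `σ`, so that taking the real part and `ENNReal.ofReal` loses nothing. -/
def algebraicConnectivity (G : WeightedGraph V) : ℝ≥0∞ :=
  ⨅ (z : V → ℂ) (_ : z ≠ 0) (_ : ∑ v, z v * (G.w v : ℂ) = 0),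
    ENNReal.ofReal
      ((star z ⬝ᵥ (G.laplacian.map Complex.ofReal).mulVec z).re / ∑ v, ‖z v‖ ^ 2 * (G.w v : ℝ))

end WeightedGraph

/-- The weighted graph associated with a signal `f` and a family `Q` of squares: vertices are the
members of the family, `w(v) = ‖S f‖_{L¹(Q_v)}` and `σ(u, v) = ‖S f‖²_{L¹(Q_u ∩ Q_v)}`
(these norms are finite for `f ∈ L²(ℝ)`). -/
def signalGraph {V : Type*} (f : ℝ → ℂ) (Q : V → Set ℂ) : WeightedGraph V where
  w v := (eLpNorm (spectrogram f) 1 (volume.restrict (Q v))).toNNReal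
  σ u v := (eLpNorm (spectrogram f) 1 (volume.restrict (Q u ∩ Q v))).toNNReal ^ 2
  symm u v := by rw [Set.inter_comm]

/-- `M = ∑_Q ‖S f‖_{L¹(Q)}⁻²`, in `[0, ∞]`. -/
def constM {V : Type*} [Fintype V] (f : ℝ → ℂ) (Q : V → Set ℂ) : ℝ≥0∞ :=
  ∑ v, (eLpNorm (spectrogram f) 1 (volume.restrict (Q v)) ^ 2)⁻¹

/-- `L = ‖∑_Q 1_Q‖_{L^∞(ℝ²)}`. -/
def constL {V : Type*} [Fintype V] (Q : V → Set ℂ) : ℝ≥0∞ :=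
  eLpNorm (fun z : ℂ => ∑ v, (Q v).indicator (fun _ => (1 : ℝ)) z) ∞ volume

/-- `K = ‖S f‖_{L^∞(ℝ²)} + ‖S g‖_{L^∞(ℝ²)}`. -/
def constK (f g : ℝ → ℂ) : ℝ≥0∞ :=
  eLpNorm (spectrogram f) ∞ volume + eLpNorm (spectrogram g) ∞ volume

end GaborStability

end

noncomputable section

namespace GaborStability

/-! Up to a weight, the conjugate of `gabor f` is entire (`conj_gabor`), and in coordinates centred
at a given unit square this weight is bounded above and below independently of the square's position
(`exists_weight_mul_entire`). Write `F`, `G` for the entire factors of `f`, `g`. The function `H p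
q` obtained by polarising `|F|² - |G|²` is holomorphic in two complex variables. At real points it
is comparable to `spectrogram f - spectrogram g`, at suitable complex points it is the difference of
the rank-one kernels `F(s') conj F(s) - G(s') conj G(s)`, and on a fixed bidisc it is `O(K)`. A
two-constants estimate in each variable therefore turns L¹-smallness of the spectrogram difference
on the square into pointwise smallness of the kernel difference, of order `(K · L¹ error)^(1/2)`
(`exists_kernel_bound`).

Nearby rank-one kernels come from nearby functions up to a phase (`exists_phase_of_kernel_le`), so
each square `Q v` carries a phase `τ v` with `gabor g ≈ τ v * gabor f` there. Two such phases must
nearly agree when the squares share energy of `f`. The error is measured by exactly the edge weights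
`σ`, so it bounds the Dirichlet form of `τ`. The Poincaré inequality with constant `λ⁻¹` then bounds
the variance of `τ` about its weighted mean, and projecting that mean to the circle gives one global
phase. Summing over the squares costs `L^(1/2)` for overlaps, `M^(1/2)` for the local errors and
`ν^(3/2)` for the edge sum (`exists_main_bound`).

The volume term is pure slack. Degenerate cases are settled by the conventions in `[0, ∞]`, with
exact uniqueness up to phase when the spectrograms agree on `Ω`. -/

/-! ### Two-constants estimates for entire functions of one and two variables. -/

lemma norm_cosh_le (z : ℂ) : ‖Complex.cosh z‖ ≤ Real.cosh z.re := by
  rw [Complex.cosh, norm_div, Real.cosh_eq]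
  have := norm_add_le (Complex.exp z) (Complex.exp (-z))
  simp only [Complex.norm_exp, Complex.neg_re] at this
  simpa using div_le_div_of_nonneg_right this (by norm_num : (0:ℝ) ≤ 2)

lemma sinh_re_le_norm_cosh (z : ℂ) : Real.sinh z.re ≤ ‖Complex.cosh z‖ := by
  rw [Complex.cosh, norm_div, Real.sinh_eq]
  have := norm_sub_norm_le (Complex.exp z) (-Complex.exp (-z))
  simp only [Complex.norm_exp, Complex.neg_re, norm_neg, sub_neg_eq_add] at this
  simpa using div_le_div_of_nonneg_right this (by norm_num : (0:ℝ) ≤ 2)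

/-- Evenness of `cosh` allows a preimage in the right half-plane, where the strips of the three
lines theorem lie. -/
lemma exists_cosh_eq (z : ℂ) : ∃ w : ℂ, 0 ≤ w.re ∧ Complex.cosh w = z := by
  obtain ⟨v, hv⟩ := Complex.cos_surjective z
  rcases le_total 0 (v * Complex.I).re with h | h
  · exact ⟨v * Complex.I, h, by rw [Complex.cosh_mul_I, hv]⟩
  · exact ⟨-(v * Complex.I), by simpa using h, by rw [Complex.cosh_neg, Complex.cosh_mul_I, hv]⟩

/-- A two-constants theorem for the segment `[-1/2, 1/2]`, obtained from the three lines theorem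
through the substitution `z = cosh w / 2`. -/
lemma norm_le_of_norm_le_on_segment {P : ℂ → ℂ}
    (hP : DifferentiableOn ℂ P (Metric.ball 0 (Real.cosh 16))) {e B : ℝ} (he : 0 ≤ e) (heB : e ≤ B)
    (hB : ∀ z : ℂ, ‖z‖ ≤ Real.cosh 16 / 2 → ‖P z‖ ≤ B)
    (hseg : ∀ x : ℝ, |x| ≤ 1 / 2 → ‖P x‖ ≤ e) {z : ℂ} (hz : ‖z‖ ≤ 2) :
    ‖P z‖ ≤ e ^ (3 / 4 : ℝ) * B ^ (1 / 4 : ℝ) := by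
  have hB0 : 0 ≤ B := he.trans heB
  obtain ⟨w, hw0, hw⟩ := exists_cosh_eq (2 * z)
  -- Here `‖cosh w‖ = ‖2z‖ ≤ 4`. In a strip of width 16 this puts `w` in the first quarter, hence
  -- the exponents 3/4 and 1/4.
  have hw4 : w.re ≤ 4 := by
    have h1 := sinh_re_le_norm_cosh w
    have h2 := Real.self_le_sinh_iff.2 hw0
    rw [hw, norm_mul] at h1
    simp at h1
    linarith
  have hbd : ∀ v : ℂ, 0 ≤ v.re → v.re ≤ 16 → ‖Complex.cosh v / 2‖ ≤ Real.cosh 16 / 2 := by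
    intro v h0 h1
    have h2 : Real.cosh v.re ≤ Real.cosh 16 := by
      rw [Real.cosh_le_cosh, abs_of_nonneg h0]; simpa using h1
    have := norm_cosh_le v
    simp only [norm_div, Complex.norm_ofNat]
    linarith
  have hc : 0 < Real.cosh 16 := Real.cosh_pos _
  have hmaps : Set.MapsTo (fun v : ℂ => Complex.cosh v / 2)
      (Complex.HadamardThreeLines.verticalClosedStrip 0 16) (Metric.ball 0 (Real.cosh 16)) := by
    intro v hv
    have := hbd v hv.1 hv.2
    simp only [mem_ball_zero_iff]
    linarith
  have hdiff : DifferentiableOn ℂ (fun v : ℂ => P (Complex.cosh v / 2))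
      (Complex.HadamardThreeLines.verticalClosedStrip 0 16) :=
    hP.comp (Complex.differentiable_cosh.div_const 2).differentiableOn hmaps
  have hclos : closure (Complex.HadamardThreeLines.verticalStrip 0 16)
      ⊆ Complex.HadamardThreeLines.verticalClosedStrip 0 16 :=
    closure_minimal (Set.preimage_mono Set.Ioo_subset_Icc_self)
      (isClosed_Icc.preimage Complex.continuous_re)
  have key := Complex.HadamardThreeLines.norm_le_interp_of_mem_verticalClosedStrip'
    (f := fun v : ℂ => P (Complex.cosh v / 2)) (z := w) (a := e) (b := B) (l := 0) (u := 16)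
    (by norm_num) ⟨hw0, by linarith⟩ (hdiff.mono hclos).diffContOnCl
    ⟨B, by
      rintro _ ⟨v, hv, rfl⟩
      exact hB _ (hbd v hv.1 hv.2)⟩
    -- The line `Re v = 0` is mapped to the segment, since `cosh (i t) / 2 = cos t / 2`.
    (by
      intro v hv
      have hv0 : v.re = 0 := hv
      have h1 : Complex.cosh v / 2 = ((Real.cos v.im / 2 : ℝ) : ℂ) := by
        have : v = v.im * Complex.I := by apply Complex.ext <;> simp [hv0]
        rw [this, Complex.cosh_mul_I]; simp
      simp only [h1]
      apply hseg
      rw [abs_div, abs_two]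
      linarith [Real.abs_cos_le_one v.im])
    (by
      intro v hv
      have hv0 : v.re = 16 := hv
      exact hB _ (hbd v (by linarith) (by linarith)))
  have hz' : Complex.cosh w / 2 = z := by rw [hw]; ring
  simp only [hz'] at key
  refine key.trans ?_
  set s : ℝ := (w.re - 0) / (16 - 0) with hs
  have hs0 : 0 ≤ s := by rw [hs]; simpa using div_nonneg hw0 (by norm_num : (0:ℝ) ≤ 16)
  have hs1 : s ≤ 1 / 4 := by rw [hs, sub_zero, sub_zero, div_le_iff₀ (by norm_num)]; linarith
  have h1 : e ^ (1 - s) = e ^ (3 / 4 : ℝ) * e ^ (1 / 4 - s) := by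
    rw [← Real.rpow_add_of_nonneg he (by norm_num) (by linarith)]; congr 1; ring
  have h2 : B ^ (1 / 4 : ℝ) = B ^ (1 / 4 - s) * B ^ s := by
    rw [← Real.rpow_add_of_nonneg hB0 (by linarith) hs0]; congr 1; ring
  rw [h1, h2, mul_assoc]
  have := Real.rpow_le_rpow he heB (by linarith : 0 ≤ 1 / 4 - s)
  gcongr

/-- An entire function that is small in `L¹([-1/2, 1/2])` and bounded on a large disc is small
on the unit disc. -/
lemma exists_norm_le_integral_segment : ∃ C R : ℝ, 1 ≤ C ∧ 1 ≤ R ∧ ∀ (H : ℂ → ℂ),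
    Differentiable ℂ H → ∀ K : ℝ, (∀ z : ℂ, ‖z‖ ≤ R → ‖H z‖ ≤ K) → ∀ z : ℂ, ‖z‖ ≤ 1 →
    ‖H z‖ ≤ C * (∫ x in (-1 / 2 : ℝ)..(1 / 2), ‖H x‖) ^ (3 / 4 : ℝ) * K ^ (1 / 4 : ℝ) := by
  have hc : 1 ≤ Real.cosh 16 := Real.one_le_cosh _
  set R := Real.cosh 16 with hR
  refine ⟨(R + 1) ^ (1 / 4 : ℝ), R, Real.one_le_rpow (by linarith) (by norm_num), hc, ?_⟩
  intro H hH K hK z hz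
  have hK0 : 0 ≤ K := (norm_nonneg _).trans (hK 0 (by simp; linarith))
  -- A primitive vanishing at the left endpoint is bounded on the segment by the L¹ norm of `H`, so
  -- the sup-norm estimate applies to it.
  obtain ⟨P, hP0, hP⟩ := (hH.differentiableOn.isExactOn_ball (c := 0) (r := R)).with_val_at
    (-1 / 2 : ℂ) 0
  set ε := ∫ x in (-1 / 2 : ℝ)..(1 / 2), ‖H x‖ with hε
  have hcont : Continuous fun x : ℝ => H x := hH.continuous.comp Complex.continuous_ofReal
  have hball : ∀ w : ℂ, ‖w‖ ≤ 2 → w ∈ Metric.ball (0 : ℂ) R := by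
    intro w hw
    have : (16 : ℝ) < Real.cosh 16 :=
      (Real.self_le_sinh_iff.2 (by norm_num)).trans_lt (Real.sinh_lt_cosh _)
    rw [mem_ball_zero_iff]; linarith
  have hε0 : 0 ≤ ε := intervalIntegral.integral_nonneg (by norm_num) fun _ _ => norm_nonneg _
  have hεK : ε ≤ K := by
    refine (intervalIntegral.integral_mono_on (g := fun _ => K) (by norm_num)
      (hcont.norm.intervalIntegrable _ _) intervalIntegrable_const fun x hx => hK _ ?_).trans
      (le_of_eq ?_)
    · rw [Complex.norm_real, Real.norm_eq_abs, abs_le]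
      constructor <;> linarith [hx.1, hx.2]
    · rw [intervalIntegral.integral_const]; norm_num
  have hseg : ∀ x : ℝ, |x| ≤ 1 / 2 → ‖P x‖ ≤ ε := by
    intro x hx
    rw [abs_le] at hx
    have h1 : ∫ t in (-1 / 2 : ℝ)..x, H t = P x - P ((-1 / 2 : ℝ) : ℂ) := by
      apply intervalIntegral.integral_eq_sub_of_hasDerivAt (f := fun t : ℝ => P t)
      · intro t ht
        rw [Set.uIcc_of_le (by linarith)] at ht
        apply (hP t (hball _ _)).comp_ofReal
        rw [Complex.norm_real, Real.norm_eq_abs, abs_le]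
        constructor <;> linarith [ht.1, ht.2]
      · exact hcont.intervalIntegrable _ _
    have h2 : P ((-1 / 2 : ℝ) : ℂ) = 0 := by rw [← hP0]; congr 1; push_cast; ring
    rw [h2, sub_zero] at h1
    rw [← h1]
    refine (intervalIntegral.norm_integral_le_integral_norm (by linarith)).trans ?_
    exact intervalIntegral.integral_mono_interval le_rfl (by linarith) (by linarith)
      (Filter.Eventually.of_forall fun _ => norm_nonneg _) (hcont.norm.intervalIntegrable _ _)
  have hPB : ∀ w : ℂ, ‖w‖ ≤ R / 2 → ‖P w‖ ≤ (R + 1) * K := by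
    intro w hw
    have h1 := (convex_ball (0 : ℂ) R).norm_image_sub_le_of_norm_hasDerivWithin_le
      (f := P) (f' := H) (C := K) (x := (-1 / 2 : ℂ)) (y := w)
      (fun v hv => (hP v hv).hasDerivWithinAt)
      (fun v hv => hK v (by rw [mem_ball_zero_iff] at hv; exact hv.le)) (hball _ (by norm_num))
      (by rw [mem_ball_zero_iff]; linarith)
    rw [hP0, sub_zero] at h1
    refine h1.trans ?_
    have h2 : ‖w - (-1 / 2)‖ ≤ R + 1 := by
      refine (norm_sub_le _ _).trans ?_
      have : ‖(-1 / 2 : ℂ)‖ = 1 / 2 := by norm_num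
      linarith
    nlinarith
  have hfin : ∀ w : ℂ, ‖w‖ ≤ 2 → ‖P w‖ ≤ ε ^ (3 / 4 : ℝ) * ((R + 1) * K) ^ (1 / 4 : ℝ) :=
    fun w hw => norm_le_of_norm_le_on_segment
      (fun v hv => (hP v hv).differentiableAt.differentiableWithinAt) hε0 (by nlinarith) hPB hseg hw
  have hd : DiffContOnCl ℂ P (Metric.ball z 1) := by
    apply DifferentiableOn.diffContOnCl
    intro v hv
    rw [closure_ball _ one_ne_zero, mem_closedBall_iff_norm] at hv
    refine (hP v (hball _ ?_)).differentiableAt.differentiableWithinAt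
    have := norm_add_le z (v - z)
    rw [add_sub_cancel] at this
    linarith
  -- Cauchy's estimate on a unit circle, which stays in the disc of radius 2, returns from `P` to `H
  -- = P'`.
  have := Complex.norm_deriv_le_of_forall_mem_sphere_norm_le one_pos hd
    (C := ε ^ (3 / 4 : ℝ) * ((R + 1) * K) ^ (1 / 4 : ℝ)) (by
      intro v hv
      apply hfin
      rw [mem_sphere_iff_norm] at hv
      have := norm_add_le z (v - z)
      rw [add_sub_cancel] at this
      linarith)
  rw [(hP z (hball _ (by linarith))).deriv, div_one, Real.mul_rpow (by linarith) hK0] at this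
  linarith

/-- Jensen's inequality: the interval has length 1 and `x ↦ x ^ p` is concave. -/
lemma integral_rpow_le_rpow_integral {h : ℝ → ℝ} (hc : Continuous h) (h0 : ∀ x, 0 ≤ h x) {p : ℝ}
    (hp0 : 0 ≤ p) (hp1 : p ≤ 1) :
    ∫ y in (-1 / 2 : ℝ)..(1 / 2), h y ^ p ≤ (∫ y in (-1 / 2 : ℝ)..(1 / 2), h y) ^ p := by
  rw [intervalIntegral.integral_of_le (by norm_num), intervalIntegral.integral_of_le (by norm_num)]
  have : IsProbabilityMeasure (volume.restrict (Set.Ioc (-1 / 2 : ℝ) (1 / 2))) :=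
    ⟨by rw [Measure.restrict_apply_univ, Real.volume_Ioc]; norm_num⟩
  refine (Real.concaveOn_rpow hp0 hp1).le_map_integral
    (fun x _ => (Real.continuousAt_rpow_const _ _ (Or.inr hp0)).continuousWithinAt) isClosed_Ici
    (Filter.Eventually.of_forall h0) (hc.integrableOn_Ioc) ?_
  exact (hc.rpow_const fun x => Or.inr hp0).integrableOn_Ioc

/-- A separately entire function of two variables that is bounded on a large bidisc and small in
`L¹([-1/2, 1/2]²)` is small on the unit bidisc. -/
lemma exists_norm_sq_le_integral_square : ∃ C R : ℝ, 1 ≤ C ∧ 1 ≤ R ∧ ∀ (H : ℂ → ℂ → ℂ),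
    Continuous (Function.uncurry H) → (∀ y, Differentiable ℂ fun x => H x y) →
    (∀ x, Differentiable ℂ fun y => H x y) →
    ∀ K : ℝ, (∀ x y : ℂ, ‖x‖ ≤ R → ‖y‖ ≤ R → ‖H x y‖ ≤ K) →
    ∀ x y : ℂ, ‖x‖ ≤ 1 → ‖y‖ ≤ 1 → ‖H x y‖ ^ 2 ≤ C * K *
      ∫ t in (-1 / 2 : ℝ)..(1 / 2), ∫ s in (-1 / 2 : ℝ)..(1 / 2), ‖H s t‖ := by
  obtain ⟨C, R, hC, hR, h⟩ := exists_norm_le_integral_segment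
  refine ⟨C ^ 4, R, one_le_pow₀ hC, hR, ?_⟩
  intro H hH hH1 hH2 K hK x y hx hy
  have hK0 : 0 ≤ K := (norm_nonneg _).trans (hK 0 0 (by simp; linarith) (by simp; linarith))
  have hreal : ∀ t ∈ Set.Icc (-1 / 2 : ℝ) (1 / 2), ‖(t : ℂ)‖ ≤ R := by
    intro t ht
    rw [Complex.norm_real, Real.norm_eq_abs, abs_le]
    constructor <;> linarith [ht.1, ht.2]
  set ε : ℝ → ℝ := fun t => ∫ s in (-1 / 2 : ℝ)..(1 / 2), ‖H s t‖ with hε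
  have hcont : Continuous fun p : ℝ × ℝ => ‖H p.2 p.1‖ :=
    (hH.comp ((Complex.continuous_ofReal.comp continuous_snd).prodMk
      (Complex.continuous_ofReal.comp continuous_fst))).norm
  have hεc : Continuous ε :=
    intervalIntegral.continuous_parametric_intervalIntegral_of_continuous' hcont _ _
  have hε0 : ∀ t, 0 ≤ ε t := fun t =>
    intervalIntegral.integral_nonneg (by norm_num) fun _ _ => norm_nonneg _
  have hεK : ∀ t ∈ Set.Icc (-1 / 2 : ℝ) (1 / 2), ε t ≤ K := by
    intro t ht
    refine (intervalIntegral.integral_mono_on (g := fun _ => K) (by norm_num)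
      ((hcont.comp (continuous_const.prodMk continuous_id)).intervalIntegrable _ _)
      intervalIntegrable_const fun s hs => hK _ _ (hreal s hs) (hreal t ht)).trans (le_of_eq ?_)
    rw [intervalIntegral.integral_const]; norm_num
  set E : ℝ := ∫ t in (-1 / 2 : ℝ)..(1 / 2), ε t with hE
  have hE0 : 0 ≤ E := intervalIntegral.integral_nonneg (by norm_num) fun t _ => hε0 t
  have hEK : E ≤ K := by
    refine (intervalIntegral.integral_mono_on (g := fun _ => K) (by norm_num)
      (hεc.intervalIntegrable _ _) intervalIntegrable_const hεK).trans (le_of_eq ?_)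
    rw [intervalIntegral.integral_const]; norm_num
  have hrow : ∀ t ∈ Set.Icc (-1 / 2 : ℝ) (1 / 2),
      ‖H x t‖ ≤ C * ε t ^ (3 / 4 : ℝ) * K ^ (1 / 4 : ℝ) := fun t ht =>
    h (fun x => H x t) (hH1 t) K (fun z hz => hK _ _ hz (hreal t ht)) x hx
  have hεp : Continuous fun t => ε t ^ (3 / 4 : ℝ) := hεc.rpow_const fun _ => Or.inr (by norm_num)
  have hint : ∫ t in (-1 / 2 : ℝ)..(1 / 2), ‖H x t‖
      ≤ C * E ^ (3 / 4 : ℝ) * K ^ (1 / 4 : ℝ) := by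
    calc ∫ t in (-1 / 2 : ℝ)..(1 / 2), ‖H x t‖
        ≤ ∫ t in (-1 / 2 : ℝ)..(1 / 2), C * ε t ^ (3 / 4 : ℝ) * K ^ (1 / 4 : ℝ) :=
          intervalIntegral.integral_mono_on (by norm_num)
            (((hH2 x).continuous.comp Complex.continuous_ofReal).norm.intervalIntegrable _ _)
            (((hεp.const_mul C).mul_const _).intervalIntegrable _ _) hrow
      _ = C * (∫ t in (-1 / 2 : ℝ)..(1 / 2), ε t ^ (3 / 4 : ℝ)) * K ^ (1 / 4 : ℝ) := by
          rw [intervalIntegral.integral_mul_const, intervalIntegral.integral_const_mul]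
      _ ≤ _ := by
          gcongr
          exact integral_rpow_le_rpow_integral hεc hε0 (by norm_num) (by norm_num)
  have hcol := h (fun y => H x y) (hH2 x) K (fun z hz => hK _ _ (by linarith) hz) y hy
  have hI0 : 0 ≤ ∫ t in (-1 / 2 : ℝ)..(1 / 2), ‖H x t‖ :=
    intervalIntegral.integral_nonneg (by norm_num) fun _ _ => norm_nonneg _
  -- Two applications of the exponent 3/4 give `E^(9/16) K^(7/16)`; sixteenth roots make all
  -- exponents integers. As 9/16 exceeds 1/2 and `E ≤ K`, the surplus of `E` can be traded for `K`.
  set p := E ^ (1 / 16 : ℝ) with hp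
  set q := K ^ (1 / 16 : ℝ) with hq
  have hp0 : 0 ≤ p := Real.rpow_nonneg hE0 _
  have hq0 : 0 ≤ q := Real.rpow_nonneg hK0 _
  have hpq : p ≤ q := Real.rpow_le_rpow hE0 hEK (by norm_num)
  have hEp : ∀ n : ℕ, E ^ ((n : ℝ) / 16) = p ^ n := fun n => by
    rw [hp, ← Real.rpow_natCast, ← Real.rpow_mul hE0]; congr 1; ring
  have hKq : ∀ n : ℕ, K ^ ((n : ℝ) / 16) = q ^ n := fun n => by
    rw [hq, ← Real.rpow_natCast, ← Real.rpow_mul hK0]; congr 1; ring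
  have e1 : E = p ^ 16 := by rw [← hEp]; norm_num
  have e2 : K = q ^ 16 := by rw [← hKq]; norm_num
  have e3 : E ^ (3 / 4 : ℝ) = p ^ 12 := by rw [← hEp]; norm_num
  have e4 : K ^ (1 / 4 : ℝ) = q ^ 4 := by rw [← hKq]; norm_num
  have e5 : (p ^ 12) ^ (3 / 4 : ℝ) = p ^ 9 := by
    rw [← Real.rpow_natCast, ← Real.rpow_natCast, ← Real.rpow_mul hp0]; norm_num
  have e6 : (q ^ 4) ^ (3 / 4 : ℝ) = q ^ 3 := by
    rw [← Real.rpow_natCast, ← Real.rpow_natCast, ← Real.rpow_mul hq0]; norm_num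
  have hCp : C ^ (3 / 4 : ℝ) ≤ C := by
    simpa using Real.rpow_le_rpow_of_exponent_le hC (by norm_num : (3 / 4 : ℝ) ≤ 1)
  have hb : ‖H x y‖ ≤ C ^ 2 * (p ^ 9 * q ^ 7) := by
    calc ‖H x y‖ ≤ C * (∫ t in (-1 / 2 : ℝ)..(1 / 2), ‖H x t‖) ^ (3 / 4 : ℝ) * K ^ (1 / 4 : ℝ) :=
          hcol
      _ ≤ C * (C * E ^ (3 / 4 : ℝ) * K ^ (1 / 4 : ℝ)) ^ (3 / 4 : ℝ) * K ^ (1 / 4 : ℝ) := by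
          gcongr
      _ = C * C ^ (3 / 4 : ℝ) * (p ^ 9 * q ^ 7) := by
          rw [e3, e4, Real.mul_rpow (by positivity) (by positivity),
            Real.mul_rpow (by positivity) (by positivity), e5, e6]; ring
      _ ≤ C ^ 2 * (p ^ 9 * q ^ 7) := by rw [pow_two]; gcongr
  calc ‖H x y‖ ^ 2 ≤ (C ^ 2 * (p ^ 9 * q ^ 7)) ^ 2 := by gcongr
    _ = C ^ 4 * (p ^ 16 * q ^ 14 * p ^ 2) := by ring
    _ ≤ C ^ 4 * (p ^ 16 * q ^ 14 * q ^ 2) := by gcongr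
    _ = C ^ 4 * K * E := by rw [e1, e2]; ring

/-! ### The Bargmann transform and regularity of the Gabor transform. -/

lemma memLp_two_exp_neg_mul_sq {b : ℝ} (hb : 0 < b) :
    MemLp (fun t : ℝ => Real.exp (-b * t ^ 2)) 2 volume := by
  rw [memLp_two_iff_integrable_sq (by fun_prop)]
  refine (integrable_exp_neg_mul_sq (b := 2 * b) (by positivity)).congr
    (Filter.Eventually.of_forall fun t => ?_)
  simp only [← Real.exp_nat_mul]
  congr 1; push_cast; ring

lemma integrable_exp_neg_mul_sq_mul_norm {h : ℝ → ℂ} (hh : MemLp h 2 volume) {b : ℝ} (hb : 0 < b) :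
    Integrable fun t : ℝ => Real.exp (-b * t ^ 2) * ‖h t‖ :=
  (memLp_two_exp_neg_mul_sq hb).integrable_mul hh.norm

/-- The holomorphic part of the Gabor transform, a Bargmann transform up to normalisation. -/
def bargmann (h : ℝ → ℂ) (z : ℂ) : ℂ :=
  ∫ t : ℝ, h t * Complex.exp (-Real.pi * t ^ 2 + 2 * Real.pi * t * z)

/-- The factor `1 + 2π|t|` dominates both the kernel and its `z`-derivative in one bound. It is
absorbed into an exponential, after which the estimate is the square `(|t| - 2(r + 1))² ≥ 0`. -/
lemma norm_bargmann_kernel_le (t : ℝ) (z : ℂ) {r : ℝ} (hz : ‖z‖ ≤ r) :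
    ‖Complex.exp (-Real.pi * t ^ 2 + 2 * Real.pi * t * z)‖ * (1 + 2 * Real.pi * |t|)
      ≤ Real.exp (2 * Real.pi * (r + 1) ^ 2) * Real.exp (-(Real.pi / 2) * t ^ 2) := by
  have hpi := Real.pi_pos
  have h1 : 1 + 2 * Real.pi * |t| ≤ Real.exp (2 * Real.pi * |t|) := by
    linarith [Real.add_one_le_exp (2 * Real.pi * |t|)]
  have h2 : (-Real.pi * t ^ 2 + 2 * Real.pi * t * z : ℂ).re
      = -Real.pi * t ^ 2 + 2 * Real.pi * (t * z.re) := by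
    simp [Complex.mul_re, pow_two]; ring
  have h3 : t * z.re ≤ |t| * r := by
    refine (le_abs_self _).trans ?_
    rw [abs_mul]
    exact mul_le_mul_of_nonneg_left ((Complex.abs_re_le_norm z).trans hz) (abs_nonneg _)
  rw [Complex.norm_exp, h2]
  refine (mul_le_mul_of_nonneg_left h1 (Real.exp_nonneg _)).trans ?_
  rw [← Real.exp_add, ← Real.exp_add, Real.exp_le_exp]
  have h4 := sq_nonneg (|t| - 2 * (r + 1))
  have h5 : |t| ^ 2 = t ^ 2 := sq_abs t
  nlinarith

lemma differentiable_bargmann {h : ℝ → ℂ} (hh : MemLp h 2 volume) :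
    Differentiable ℂ (bargmann h) := by
  intro z₀
  have hm : ∀ z : ℂ, AEStronglyMeasurable
      (fun t : ℝ => h t * Complex.exp (-Real.pi * t ^ 2 + 2 * Real.pi * t * z)) volume := fun z =>
    hh.1.mul (by fun_prop)
  set r := ‖z₀‖ + 1 with hr
  have hbi : Integrable (fun t : ℝ =>
      Real.exp (2 * Real.pi * (r + 1) ^ 2) * (Real.exp (-(Real.pi / 2) * t ^ 2) * ‖h t‖)) :=
    (integrable_exp_neg_mul_sq_mul_norm hh (by positivity)).const_mul _
  have hk1 : ∀ (t : ℝ) (z : ℂ), ‖z‖ ≤ r →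
      ‖h t * Complex.exp (-Real.pi * t ^ 2 + 2 * Real.pi * t * z)‖ * (1 + 2 * Real.pi * |t|)
      ≤ Real.exp (2 * Real.pi * (r + 1) ^ 2) * (Real.exp (-(Real.pi / 2) * t ^ 2) * ‖h t‖) := by
    intro t z hz
    have := mul_le_mul_of_nonneg_left (norm_bargmann_kernel_le t z hz) (norm_nonneg (h t))
    rw [norm_mul]
    linarith
  have := (hasDerivAt_integral_of_dominated_loc_of_deriv_le (μ := volume) (𝕜 := ℂ)
    (F := fun (z : ℂ) (t : ℝ) => h t * Complex.exp (-Real.pi * t ^ 2 + 2 * Real.pi * t * z))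
    (F' := fun (z : ℂ) (t : ℝ) =>
      h t * (Complex.exp (-Real.pi * t ^ 2 + 2 * Real.pi * t * z) * (2 * Real.pi * t)))
    (x₀ := z₀) (s := Metric.ball z₀ 1)
    (bound := fun t : ℝ =>
      Real.exp (2 * Real.pi * (r + 1) ^ 2) * (Real.exp (-(Real.pi / 2) * t ^ 2) * ‖h t‖))
    (Metric.ball_mem_nhds _ one_pos) (Filter.Eventually.of_forall hm)
    (hbi.mono' (hm z₀) (Filter.Eventually.of_forall fun t => by
      refine le_trans ?_ (hk1 t z₀ (by linarith))
      apply le_mul_of_one_le_right (norm_nonneg _)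
      have : 0 ≤ 2 * Real.pi * |t| := by positivity
      linarith))
    (hh.1.mul (by fun_prop))
    (Filter.Eventually.of_forall fun t z hz => by
      have hz' : ‖z‖ ≤ r := by
        rw [mem_ball_iff_norm] at hz
        have := norm_add_le z₀ (z - z₀)
        rw [add_sub_cancel] at this
        linarith
      refine le_trans ?_ (hk1 t z hz')
      rw [← mul_assoc, norm_mul]
      gcongr
      simp [abs_of_pos Real.pi_pos])
    hbi
    (Filter.Eventually.of_forall fun t z _ => by
      have h1 : HasDerivAt (fun z : ℂ => (-Real.pi * t ^ 2 + 2 * Real.pi * t * z : ℂ))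
          (2 * Real.pi * t) z := by
        simpa using ((hasDerivAt_id z).const_mul (2 * Real.pi * t : ℂ)).const_add
          (-Real.pi * t ^ 2 : ℂ)
      exact h1.cexp.const_mul (h t))).2
  exact this.differentiableAt

/-- With the kernel `exp (-2πi t y)` the Gabor transform is antiholomorphic up to a weight, so
conjugation is needed to reach functions of `x + i y`. -/
lemma conj_gabor (f : ℝ → ℂ) (z : ℂ) :
    starRingEnd ℂ (gabor f z)
      = Complex.exp (-Real.pi * z.re ^ 2) * bargmann (fun t => starRingEnd ℂ (f t)) z := by
  rw [gabor, bargmann, Real.fourier_real_eq_integral_exp_smul, ← integral_conj,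
    ← integral_const_mul]
  congr 1
  ext t
  simp only [smul_eq_mul, map_mul, ← Complex.exp_conj, Complex.conj_ofReal, Complex.conj_I,
    Complex.ofReal_exp]
  rw [mul_left_comm, mul_left_comm _ (starRingEnd ℂ (f t)), ← Complex.exp_add, ← Complex.exp_add]
  congr 2
  nth_rw 4 [← Complex.re_add_im z]
  push_cast
  ring

lemma memLp_conj {f : ℝ → ℂ} (hf : MemLp f 2 volume) :
    MemLp (fun t => starRingEnd ℂ (f t)) 2 volume :=
  hf.star

lemma continuous_gabor {f : ℝ → ℂ} (hf : MemLp f 2 volume) : Continuous (gabor f) := by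
  have h : Continuous fun z => starRingEnd ℂ (gabor f z) := by
    simp_rw [conj_gabor]
    have := (differentiable_bargmann (memLp_conj hf)).continuous
    fun_prop
  simpa only [Function.comp_def, Complex.conj_conj] using Complex.continuous_conj.comp h

lemma continuous_spectrogram {f : ℝ → ℂ} (hf : MemLp f 2 volume) : Continuous (spectrogram f) :=
  (continuous_gabor hf).norm.pow 2

/-- The crude bound `ab ≤ a² + b²` suffices: it only serves to make `constK` finite. -/
lemma exists_spectrogram_le {f : ℝ → ℂ} (hf : MemLp f 2 volume) :
    ∃ B : ℝ, ∀ z, spectrogram f z ≤ B := by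
  have hg := (memLp_two_iff_integrable_sq (by fun_prop)).1
    (memLp_two_exp_neg_mul_sq Real.pi_pos)
  have hf2 := (memLp_two_iff_integrable_sq_norm hf.1).1 hf
  refine ⟨((∫ t, ‖f t‖ ^ 2) + ∫ t : ℝ, Real.exp (-Real.pi * t ^ 2) ^ 2) ^ 2, fun z => ?_⟩
  unfold spectrogram
  gcongr
  have hgt := hg.comp_sub_right z.re
  rw [gabor, Real.fourier_real_eq,
    ← integral_sub_right_eq_self (fun t : ℝ => Real.exp (-Real.pi * t ^ 2) ^ 2) z.re,
    ← integral_add hf2 hgt]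
  refine norm_integral_le_of_norm_le (hf2.add hgt) (Filter.Eventually.of_forall fun t => ?_)
  rw [Circle.norm_smul, norm_mul, Complex.norm_real, Real.norm_eq_abs, Real.abs_exp]
  have := two_mul_le_add_sq ‖f t‖ (Real.exp (-Real.pi * (t - z.re) ^ 2))
  have h0 : 0 ≤ ‖f t‖ * Real.exp (-Real.pi * (t - z.re) ^ 2) := by positivity
  linarith

/-- In coordinates adapted to a rigid motion `s ↦ z₀ + u s`, the Gabor transform is conjugate to an
entire function times a weight that depends on the motion alone. -/
lemma exists_weight_mul_entire (z₀ : ℂ) (u : Circle) : ∃ ω : ℂ → ℂ,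
    (∀ s, Real.exp (-Real.pi * ‖s‖ ^ 2) ≤ ‖ω s‖ ∧ ‖ω s‖ ≤ 1) ∧
    ∀ f : ℝ → ℂ, MemLp f 2 volume → ∃ F : ℂ → ℂ, Differentiable ℂ F ∧
      ∀ s, starRingEnd ℂ (gabor f (z₀ + u * s)) = ω s * F s := by
  -- Expanding `(Re z₀ + Re (u s))²`, the cross term is completed to the entire exponent `-2π Re z₀
  -- · u s`. What this adds is a unimodular factor, so `‖ω‖` does not depend on `z₀`.
  refine ⟨fun s => Complex.exp (-Real.pi * (u * s).re ^ 2
    + 2 * Real.pi * z₀.re * (u * s).im * Complex.I), fun s => ?_, fun f hf =>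
    ⟨fun s => Complex.exp (-Real.pi * z₀.re ^ 2 - 2 * Real.pi * z₀.re * (u * s)) *
      bargmann (fun t => starRingEnd ℂ (f t)) (z₀ + u * s), ?_, fun s => ?_⟩⟩
  · have h1 : (-Real.pi * (u * s).re ^ 2
        + 2 * Real.pi * z₀.re * (u * s).im * Complex.I : ℂ).re = -Real.pi * (u * s : ℂ).re ^ 2 := by
      have : (-Real.pi * (u * s).re ^ 2 + 2 * Real.pi * z₀.re * (u * s).im * Complex.I : ℂ)
        = ((-Real.pi * (u * s : ℂ).re ^ 2 : ℝ) : ℂ)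
          + ((2 * Real.pi * z₀.re * (u * s : ℂ).im : ℝ) : ℂ) * Complex.I := by push_cast; ring
      rw [this]
      simp only [Complex.add_re, Complex.ofReal_re, Complex.re_ofReal_mul, Complex.I_re, mul_zero,
        add_zero]
    have h2 : |(u * s : ℂ).re| ≤ ‖s‖ := by
      refine (Complex.abs_re_le_norm _).trans (le_of_eq ?_)
      rw [norm_mul, Circle.norm_coe, one_mul]
    have h3 : (u * s : ℂ).re ^ 2 ≤ ‖s‖ ^ 2 := by
      rw [← sq_abs]; gcongr
    rw [Complex.norm_exp, h1]
    constructor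
    · rw [Real.exp_le_exp]
      nlinarith [Real.pi_pos]
    · rw [Real.exp_le_one_iff]
      nlinarith [Real.pi_pos, sq_nonneg (u * s : ℂ).re]
  · have := differentiable_bargmann (memLp_conj hf)
    have h2 : Differentiable ℂ fun s : ℂ => z₀ + u * s := by fun_prop
    exact Differentiable.mul (by fun_prop) (this.comp h2)
  · rw [conj_gabor, ← mul_assoc, ← Complex.exp_add]
    congr 2
    have h := Complex.re_add_im (u * s)
    rw [Complex.add_re, Complex.ofReal_add]
    linear_combination (-2 * Real.pi * z₀.re : ℂ) * h

/-! ### Geometry and integration on unit squares. -/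

lemma norm_sq_le_of_mem_unit_reProdIm {s : ℂ}
    (hs : s ∈ Set.Icc (-1 / 2 : ℝ) (1 / 2) ×ℂ Set.Icc (-1 / 2 : ℝ) (1 / 2)) :
    ‖s‖ ^ 2 ≤ 1 / 2 := by
  obtain ⟨⟨h1, h2⟩, h3, h4⟩ := hs
  rw [← Complex.normSq_eq_norm_sq, Complex.normSq_apply]
  nlinarith

lemma setIntegral_unit_reProdIm {h : ℂ → ℝ} (hc : Continuous h) :
    ∫ z in (Set.Icc (-1 / 2 : ℝ) (1 / 2) ×ℂ Set.Icc (-1 / 2 : ℝ) (1 / 2)), h z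
      = ∫ t in (-1 / 2 : ℝ)..(1 / 2), ∫ s in (-1 / 2 : ℝ)..(1 / 2), h (t + s * Complex.I) := by
  have h1 := Complex.volume_preserving_equiv_real_prod.symm.setIntegral_preimage_emb
    Complex.measurableEquivRealProd.symm.measurableEmbedding h
    (Set.Icc (-1 / 2 : ℝ) (1 / 2) ×ℂ Set.Icc (-1 / 2 : ℝ) (1 / 2))
  have h2 : Complex.measurableEquivRealProd.symm ⁻¹'
      (Set.Icc (-1 / 2 : ℝ) (1 / 2) ×ℂ Set.Icc (-1 / 2 : ℝ) (1 / 2))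
      = Set.Icc (-1 / 2 : ℝ) (1 / 2) ×ˢ Set.Icc (-1 / 2 : ℝ) (1 / 2) := by
    ext p
    simp only [Set.mem_preimage, Complex.mem_reProdIm, Complex.measurableEquivRealProd_symm_apply,
      Set.mem_prod]
  have h3 : ∀ p : ℝ × ℝ, Complex.measurableEquivRealProd.symm p = p.1 + p.2 * Complex.I := by
    intro p
    rw [Complex.measurableEquivRealProd_symm_apply, Complex.mk_eq_add_mul_I]
  rw [h2] at h1
  simp only [h3] at h1
  have hc' : Continuous fun p : ℝ × ℝ => h (p.1 + p.2 * Complex.I) := by fun_prop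
  rw [← h1, Measure.volume_eq_prod, setIntegral_prod _
    (hc'.continuousOn.integrableOn_compact (isCompact_Icc.prod isCompact_Icc))]
  simp only [intervalIntegral.integral_of_le (show (-1 / 2 : ℝ) ≤ 1 / 2 by norm_num),
    integral_Icc_eq_integral_Ioc]

/-- The rigid motion `s ↦ z₀ + u s` of the plane. -/
def rigidMotion (z₀ : ℂ) (u : Circle) : ℂ ≃ᵢ ℂ :=
  (rotation u).toIsometryEquiv.trans (IsometryEquiv.addLeft z₀)

lemma measurePreserving_rigidMotion (z₀ : ℂ) (u : Circle) :
    MeasurePreserving (rigidMotion z₀ u) :=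
  (measurePreserving_add_left volume z₀).comp (rotation u).measurePreserving

lemma setIntegral_image_rigidMotion (z₀ : ℂ) (u : Circle) (h : ℂ → ℝ) (s : Set ℂ) :
    ∫ z in (fun z : ℂ => z₀ + (u : ℂ) * z) '' s, h z = ∫ z in s, h (z₀ + u * z) :=
  (measurePreserving_rigidMotion z₀ u).setIntegral_image_emb
    (rigidMotion z₀ u).toHomeomorph.measurableEmbedding h s

lemma isCompact_unit_reProdIm :
    IsCompact (Set.Icc (-1 / 2 : ℝ) (1 / 2) ×ℂ Set.Icc (-1 / 2 : ℝ) (1 / 2)) :=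
  isCompact_Icc.reProdIm isCompact_Icc

lemma IsUnitSquare.isCompact {Q : Set ℂ} (hQ : IsUnitSquare Q) : IsCompact Q := by
  obtain ⟨z₀, u, rfl⟩ := hQ
  exact isCompact_unit_reProdIm.image (by fun_prop)

lemma IsUnitSquare.measurableSet {Q : Set ℂ} (hQ : IsUnitSquare Q) : MeasurableSet Q :=
  hQ.isCompact.measurableSet

lemma IsUnitSquare.volume_eq_one {Q : Set ℂ} (hQ : IsUnitSquare Q) : volume Q = 1 := by
  have hfin := hQ.isCompact.measure_lt_top (μ := volume)
  obtain ⟨z₀, u, rfl⟩ := hQ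
  have h1 := setIntegral_image_rigidMotion z₀ u (fun _ => 1)
    (Set.Icc (-1 / 2 : ℝ) (1 / 2) ×ℂ Set.Icc (-1 / 2 : ℝ) (1 / 2))
  rw [setIntegral_unit_reProdIm continuous_const] at h1
  simp only [integral_const, intervalIntegral.integral_const, measureReal_restrict_apply_univ,
    smul_eq_mul, mul_one] at h1
  rw [show (1 / 2 - -1 / 2 : ℝ) * (1 / 2 - -1 / 2) = 1 by norm_num, Measure.real,
    ENNReal.toReal_eq_one_iff] at h1
  exact h1

lemma IsUnitSquare.exists_mem_nhds {Q : Set ℂ} (hQ : IsUnitSquare Q) : ∃ z, Q ∈ nhds z := by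
  obtain ⟨z₀, u, rfl⟩ := hQ
  refine ⟨rigidMotion z₀ u 0, (rigidMotion z₀ u).toHomeomorph.isOpenMap.image_mem_nhds ?_⟩
  refine Filter.mem_of_superset ((isOpen_Ioo.reProdIm isOpen_Ioo).mem_nhds ?_)
    (Set.inter_subset_inter (Set.preimage_mono (Set.Ioo_subset_Icc_self (a := (-1 / 2 : ℝ))
      (b := 1 / 2))) (Set.preimage_mono (Set.Ioo_subset_Icc_self (a := (-1 / 2 : ℝ)) (b := 1 / 2))))
  simp only [Complex.mem_reProdIm, Complex.zero_re, Complex.zero_im, Set.mem_Ioo]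
  norm_num

/-! ### From the spectrogram difference to the kernel difference on a square. -/

lemma norm_mul_conj_sub_mul_conj_le (a a' b b' : ℂ) {X : ℝ} (h : ‖a‖ ^ 2 + ‖b‖ ^ 2 ≤ X)
    (h' : ‖a'‖ ^ 2 + ‖b'‖ ^ 2 ≤ X) :
    ‖a * starRingEnd ℂ a' - b * starRingEnd ℂ b'‖ ≤ X := by
  refine (norm_sub_le _ _).trans ?_
  rw [norm_mul, norm_mul, RCLike.norm_conj, RCLike.norm_conj]
  nlinarith [sq_nonneg (‖a‖ - ‖a'‖), sq_nonneg (‖b‖ - ‖b'‖)]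

/-- On a unit square, the rank-one kernel of the Gabor transform is controlled by the
spectrogram. -/
lemma exists_kernel_bound : ∃ C : ℝ, 1 ≤ C ∧ ∀ f g : ℝ → ℂ, MemLp f 2 volume → MemLp g 2 volume →
    ∀ K : ℝ, (∀ z, spectrogram f z + spectrogram g z ≤ K) → ∀ Q, IsUnitSquare Q →
    ∀ z ∈ Q, ∀ z' ∈ Q,
      ‖gabor f z * starRingEnd ℂ (gabor f z') - gabor g z * starRingEnd ℂ (gabor g z')‖ ^ 2
        ≤ C * K * ∫ z in Q, |spectrogram f z - spectrogram g z| := by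
  obtain ⟨C, R, hC, hR, key⟩ := exists_norm_sq_le_integral_square
  have hpi := Real.pi_pos
  refine ⟨C * Real.exp (2 * Real.pi * (2 * R) ^ 2) * Real.exp Real.pi, ?_, ?_⟩
  · have h1 : 1 ≤ Real.exp (2 * Real.pi * (2 * R) ^ 2) := Real.one_le_exp (by positivity)
    have h2 : 1 ≤ Real.exp Real.pi := Real.one_le_exp hpi.le
    exact one_le_mul_of_one_le_of_one_le (one_le_mul_of_one_le_of_one_le hC h1) h2
  rintro f g hf hg K hK Q ⟨z₀, u, rfl⟩ _ ⟨s, hs, rfl⟩ _ ⟨s', hs', rfl⟩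
  dsimp only
  obtain ⟨ω, hω, hrep⟩ := exists_weight_mul_entire z₀ u
  obtain ⟨F, hF, hfF⟩ := hrep f hf
  obtain ⟨G, hG, hgG⟩ := hrep g hg
  have hSf : ∀ v, spectrogram f (z₀ + u * v) = ‖ω v‖ ^ 2 * ‖F v‖ ^ 2 := fun v => by
    rw [spectrogram, ← RCLike.norm_conj, hfF, norm_mul, mul_pow]
  have hSg : ∀ v, spectrogram g (z₀ + u * v) = ‖ω v‖ ^ 2 * ‖G v‖ ^ 2 := fun v => by
    rw [spectrogram, ← RCLike.norm_conj, hgG, norm_mul, mul_pow]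
  have hωsq : ∀ v r, ‖v‖ ^ 2 ≤ r → 1 ≤ Real.exp (2 * Real.pi * r) * ‖ω v‖ ^ 2 := fun v r hv => by
    have h1 : Real.exp (-Real.pi * ‖v‖ ^ 2) ^ 2 ≤ ‖ω v‖ ^ 2 := by
      gcongr
      exact (hω v).1
    rw [← Real.exp_nat_mul] at h1
    refine le_trans ?_ (mul_le_mul_of_nonneg_left h1 (Real.exp_nonneg _))
    rw [← Real.exp_add]
    apply Real.one_le_exp
    push_cast
    nlinarith
  have hS0 : ∀ v, 0 ≤ ‖F v‖ ^ 2 + ‖G v‖ ^ 2 := fun v => by positivity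
  have hFG : ∀ v : ℂ, ‖v‖ ≤ 2 * R →
      ‖F v‖ ^ 2 + ‖G v‖ ^ 2 ≤ Real.exp (2 * Real.pi * (2 * R) ^ 2) * K := fun v hv => by
    have h1 := hωsq v _ (pow_le_pow_left₀ (norm_nonneg _) hv 2)
    have h2 := hK (z₀ + u * v)
    rw [hSf, hSg, ← mul_add] at h2
    calc ‖F v‖ ^ 2 + ‖G v‖ ^ 2
        ≤ (Real.exp (2 * Real.pi * (2 * R) ^ 2) * ‖ω v‖ ^ 2) * (‖F v‖ ^ 2 + ‖G v‖ ^ 2) :=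
          le_mul_of_one_le_left (hS0 v) h1
      _ = Real.exp (2 * Real.pi * (2 * R) ^ 2) * (‖ω v‖ ^ 2 * (‖F v‖ ^ 2 + ‖G v‖ ^ 2)) := by ring
      _ ≤ _ := by gcongr
  -- Reflection makes `conj F` entire, so that `‖F‖² - ‖G‖²` extends holomorphically from real
  -- coordinates to `ℂ × ℂ`.
  let F' : ℂ → ℂ := fun v => starRingEnd ℂ (F (starRingEnd ℂ v))
  let G' : ℂ → ℂ := fun v => starRingEnd ℂ (G (starRingEnd ℂ v))
  have hF' : Differentiable ℂ F' := fun v =>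
    differentiableAt_conj_conj_iff.2 (hF _)
  have hG' : Differentiable ℂ G' := fun v =>
    differentiableAt_conj_conj_iff.2 (hG _)
  let H : ℂ → ℂ → ℂ := fun p q => F (q + p * Complex.I) * F' (q - p * Complex.I)
    - G (q + p * Complex.I) * G' (q - p * Complex.I)
  have hHc : Continuous (Function.uncurry H) := by
    have h1 := hF.continuous
    have h2 := hG.continuous
    have h3 := hF'.continuous
    have h4 := hG'.continuous
    simp only [Function.uncurry_def, H]
    fun_prop
  have hH1 : ∀ q, Differentiable ℂ fun p => H p q := fun q => by
    simp only [H]; fun_prop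
  have hH2 : ∀ p, Differentiable ℂ fun q => H p q := fun p => by
    simp only [H]; fun_prop
  have hHK : ∀ p q : ℂ, ‖p‖ ≤ R → ‖q‖ ≤ R →
      ‖H p q‖ ≤ Real.exp (2 * Real.pi * (2 * R) ^ 2) * K := fun p q hp hq => by
    -- For complex `p`, `q` the points `q ± i p` may leave the disc of radius `R`, hence the radius
    -- `2R` in `hFG`.
    have h1 : ‖q + p * Complex.I‖ ≤ 2 * R := (norm_add_le _ _).trans (by simp; linarith)
    have h2 : ‖starRingEnd ℂ (q - p * Complex.I)‖ ≤ 2 * R := by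
      rw [RCLike.norm_conj]
      exact (norm_sub_le _ _).trans (by simp; linarith)
    exact norm_mul_conj_sub_mul_conj_le _ _ _ _ (hFG _ h1) (hFG _ h2)
  have hdiag : ∀ p ∈ Set.Icc (-1 / 2 : ℝ) (1 / 2), ∀ q ∈ Set.Icc (-1 / 2 : ℝ) (1 / 2),
      ‖H p q‖ ≤ Real.exp Real.pi * |spectrogram f (z₀ + u * (q + p * Complex.I))
        - spectrogram g (z₀ + u * (q + p * Complex.I))| := by
    intro p hp q hq
    set v : ℂ := q + p * Complex.I with hv
    have hvs : ‖v‖ ^ 2 ≤ 1 / 2 := norm_sq_le_of_mem_unit_reProdIm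
      (by
        have h1 : v.re = q := by simp [hv]
        have h2 : v.im = p := by simp [hv]
        rw [Complex.mem_reProdIm, h1, h2]
        exact ⟨hq, hp⟩)
    have hvc : starRingEnd ℂ (q - p * Complex.I) = v := by
      simp [hv]
    have h1 : H p q = ((‖F v‖ ^ 2 - ‖G v‖ ^ 2 : ℝ) : ℂ) := by
      simp only [H, F', G', hvc, ← hv]
      rw [Complex.mul_conj, Complex.mul_conj, Complex.normSq_eq_norm_sq, Complex.normSq_eq_norm_sq]
      push_cast; ring
    have h2 := hωsq v _ hvs
    rw [show 2 * Real.pi * (1 / 2) = Real.pi by ring] at h2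
    rw [h1, Complex.norm_real, Real.norm_eq_abs, hSf, hSg, ← mul_sub, abs_mul, ← mul_assoc,
      abs_of_nonneg (sq_nonneg ‖ω v‖)]
    exact le_mul_of_one_le_left (abs_nonneg _) h2
  have hcS : Continuous fun z => |spectrogram f z - spectrogram g z| :=
    ((continuous_spectrogram hf).sub (continuous_spectrogram hg)).abs
  have hint : ∫ t in (-1 / 2 : ℝ)..(1 / 2), ∫ s in (-1 / 2 : ℝ)..(1 / 2), ‖H s t‖
      ≤ Real.exp Real.pi * ∫ z in (fun z : ℂ => z₀ + (u : ℂ) * z) ''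
        (Set.Icc (-1 / 2 : ℝ) (1 / 2) ×ℂ Set.Icc (-1 / 2 : ℝ) (1 / 2)),
        |spectrogram f z - spectrogram g z| := by
    have hcu : Continuous fun z =>
        |spectrogram f (z₀ + (u : ℂ) * z) - spectrogram g (z₀ + (u : ℂ) * z)| :=
      hcS.comp (by fun_prop : Continuous fun z : ℂ => z₀ + u * z)
    rw [setIntegral_image_rigidMotion, setIntegral_unit_reProdIm hcu,
      ← intervalIntegral.integral_const_mul]
    simp only [← intervalIntegral.integral_const_mul]
    have hc1 : Continuous fun p : ℝ × ℝ => ‖H p.2 p.1‖ :=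
      (hHc.comp ((Complex.continuous_ofReal.comp continuous_snd).prodMk
        (Complex.continuous_ofReal.comp continuous_fst))).norm
    have hc2 : Continuous fun p : ℝ × ℝ => Real.exp Real.pi *
        |spectrogram f (z₀ + u * (p.1 + p.2 * Complex.I))
          - spectrogram g (z₀ + u * (p.1 + p.2 * Complex.I))| :=
      continuous_const.mul (hcS.comp (by fun_prop :
        Continuous fun p : ℝ × ℝ => (z₀ + u * (p.1 + p.2 * Complex.I) : ℂ)))
    refine intervalIntegral.integral_mono_on (by norm_num)
      ((intervalIntegral.continuous_parametric_intervalIntegral_of_continuous' hc1 _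
        _).intervalIntegrable _ _)
      ((intervalIntegral.continuous_parametric_intervalIntegral_of_continuous' hc2 _
        _).intervalIntegrable _ _) fun q hq => ?_
    exact intervalIntegral.integral_mono_on (by norm_num)
      ((hc1.comp (continuous_const.prodMk continuous_id)).intervalIntegrable _ _)
      ((hc2.comp (continuous_const.prodMk continuous_id)).intervalIntegrable _ _)
      fun p hp => hdiag p hp q hq
  have hs1 : ‖s‖ ≤ 1 := by
    have := norm_sq_le_of_mem_unit_reProdIm hs
    nlinarith [norm_nonneg s]
  have hs1' : ‖s'‖ ≤ 1 := by
    have := norm_sq_le_of_mem_unit_reProdIm hs'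
    nlinarith [norm_nonneg s']
  -- These `p`, `q` solve `q + i p = s'` and `q - i p = conj s`, which makes `H p q` the kernel
  -- difference at `(s', s)`.
  have hp1 : ‖(s' - starRingEnd ℂ s) / (2 * Complex.I)‖ ≤ 1 := by
    rw [norm_div, norm_mul, Complex.norm_I, Complex.norm_ofNat, mul_one, div_le_one (by norm_num)]
    refine (norm_sub_le _ _).trans ?_
    rw [RCLike.norm_conj]; linarith
  have hq1 : ‖(s' + starRingEnd ℂ s) / 2‖ ≤ 1 := by
    rw [norm_div, Complex.norm_ofNat, div_le_one (by norm_num)]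
    refine (norm_add_le _ _).trans ?_
    rw [RCLike.norm_conj]; linarith
  have hkey := key H hHc hH1 hH2 _ hHK _ _ hp1 hq1
  have e0 : (s' - starRingEnd ℂ s) / (2 * Complex.I) * Complex.I = (s' - starRingEnd ℂ s) / 2 := by
    field_simp
  have hHval : H ((s' - starRingEnd ℂ s) / (2 * Complex.I)) ((s' + starRingEnd ℂ s) / 2)
      = F s' * starRingEnd ℂ (F s) - G s' * starRingEnd ℂ (G s) := by
    have e1 : (s' + starRingEnd ℂ s) / 2 + (s' - starRingEnd ℂ s) / 2 = s' := by ring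
    have e2 : (s' + starRingEnd ℂ s) / 2 - (s' - starRingEnd ℂ s) / 2 = starRingEnd ℂ s := by ring
    simp only [H, F', G', e0, e1, e2, Complex.conj_conj]
  rw [hHval] at hkey
  have hfs : ∀ v, gabor f (z₀ + u * v) = starRingEnd ℂ (ω v * F v) := fun v => by
    rw [← hfF, Complex.conj_conj]
  have hgs : ∀ v, gabor g (z₀ + u * v) = starRingEnd ℂ (ω v * G v) := fun v => by
    rw [← hgG, Complex.conj_conj]
  have hle : ‖gabor f (z₀ + u * s) * starRingEnd ℂ (gabor f (z₀ + u * s'))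
      - gabor g (z₀ + u * s) * starRingEnd ℂ (gabor g (z₀ + u * s'))‖
      ≤ ‖F s' * starRingEnd ℂ (F s) - G s' * starRingEnd ℂ (G s)‖ := by
    have : gabor f (z₀ + u * s) * starRingEnd ℂ (gabor f (z₀ + u * s'))
      - gabor g (z₀ + u * s) * starRingEnd ℂ (gabor g (z₀ + u * s'))
      = (starRingEnd ℂ (ω s) * ω s') *
        (F s' * starRingEnd ℂ (F s) - G s' * starRingEnd ℂ (G s)) := by
      rw [hfF, hgG, hfs, hgs, map_mul, map_mul]; ring
    rw [this, norm_mul, norm_mul, RCLike.norm_conj]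
    exact mul_le_of_le_one_left (norm_nonneg _)
      (mul_le_one₀ (hω s).2 (norm_nonneg _) (hω s').2)
  have hK0 : 0 ≤ K := (add_nonneg (sq_nonneg _) (sq_nonneg _)).trans (hK 0)
  calc _ ≤ ‖F s' * starRingEnd ℂ (F s) - G s' * starRingEnd ℂ (G s)‖ ^ 2 := by gcongr
    _ ≤ _ := hkey
    _ ≤ C * (Real.exp (2 * Real.pi * (2 * R) ^ 2) * K) * (Real.exp Real.pi *
        ∫ z in (fun z : ℂ => z₀ + (u : ℂ) * z) ''
        (Set.Icc (-1 / 2 : ℝ) (1 / 2) ×ℂ Set.Icc (-1 / 2 : ℝ) (1 / 2)),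
        |spectrogram f z - spectrogram g z|) := by gcongr
    _ = _ := by ring

/-! ### Extracting phases. -/

lemma exists_circle_norm_mul (z : ℂ) : ∃ u : Circle, z = ‖z‖ * u :=
  ⟨Circle.exp z.arg, by rw [Circle.coe_exp, Complex.norm_mul_exp_arg_mul_I]⟩

/-- If the rank-one kernels of `a` and `b` are close then so are `a` and `b`, up to a phase. -/
lemma exists_phase_of_kernel_le {X : Type*} [TopologicalSpace X] {Q : Set X} (hQ : IsCompact Q)
    {a b : X → ℂ} (ha : ContinuousOn a Q) {δ : ℝ}
    (h : ∀ z ∈ Q, ∀ z' ∈ Q, ‖a z * starRingEnd ℂ (a z') - b z * starRingEnd ℂ (b z')‖ ≤ δ) :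
    ∃ τ : Circle, ∀ z ∈ Q, ∀ z' ∈ Q, ‖b z - τ * a z‖ * ‖a z'‖ ≤ 4 * δ := by
  rcases Q.eq_empty_or_nonempty with rfl | hne
  · exact ⟨1, by simp⟩
  -- The phase is chosen to align `b w` with `a w` at a maximum of `‖a‖`; it then suffices to treat
  -- `z' = w`.
  obtain ⟨w, hw, hmax⟩ := hQ.exists_isMaxOn hne ha.norm
  have hmax' : ∀ z ∈ Q, ‖a z‖ ≤ ‖a w‖ := fun z hz => hmax hz
  obtain ⟨u, hu⟩ := exists_circle_norm_mul (a w)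
  obtain ⟨v, hv⟩ := exists_circle_norm_mul (b w)
  have hδ : 0 ≤ δ := (norm_nonneg _).trans (h w hw w hw)
  have hdiag : ∀ z ∈ Q, |‖a z‖ ^ 2 - ‖b z‖ ^ 2| ≤ δ := by
    intro z hz
    have h1 := h z hz z hz
    rw [Complex.mul_conj, Complex.mul_conj, Complex.normSq_eq_norm_sq, Complex.normSq_eq_norm_sq,
      ← Complex.ofReal_sub, Complex.norm_real] at h1
    exact h1
  refine ⟨v * u⁻¹, fun z hz z' hz' => ?_⟩
  set τ := v * u⁻¹ with hτ
  set A := ‖a w‖ with hA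
  set B := ‖b w‖ with hB
  have hA0 : 0 ≤ A := norm_nonneg _
  have hB0 : 0 ≤ B := norm_nonneg _
  have hx0 : 0 ≤ ‖b z - τ * a z‖ := norm_nonneg _
  refine (mul_le_mul_of_nonneg_left (hmax' z' hz') hx0).trans ?_
  have hτa : ‖(τ : ℂ) * a z‖ = ‖a z‖ := by rw [norm_mul, Circle.norm_coe, one_mul]
  have h1 : ‖(A : ℂ) * (τ * a z) - B * b z‖ ≤ δ := by
    refine le_trans (le_of_eq ?_) (h z hz w hw)
    have e : (A : ℂ) * (τ * a z) - B * b z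
        = (v : ℂ) * (a z * starRingEnd ℂ (a w) - b z * starRingEnd ℂ (b w)) := by
      have hvv : (v : ℂ) * starRingEnd ℂ (v : ℂ) = 1 := by
        rw [Complex.mul_conj, Circle.normSq_coe, Complex.ofReal_one]
      rw [hu, hv]
      simp only [map_mul, Complex.conj_ofReal, hτ, Circle.coe_mul, Circle.coe_inv_eq_conj]
      linear_combination (B * b z : ℂ) * hvv
    rw [e, norm_mul, Circle.norm_coe, one_mul]
  have h2 := hdiag w hw
  have h3 := hdiag z hz
  have h4 := hmax' z hz
  rw [abs_le] at h2 h3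
  -- If `B` is comparable to `A`, dividing the kernel relation at `w` by `B` is harmless. Otherwise
  -- `A² - B² ≤ δ` forces `A² ≤ 4δ/3`, and the triangle inequality is enough.
  by_cases hcase : A ≤ 2 * B
  · have h5 : B * ‖b z - τ * a z‖ ≤ δ + |A - B| * ‖a z‖ := by
      have e : (B : ℂ) * (b z - τ * a z)
          = -(A * (τ * a z) - B * b z) + (A - B : ℝ) * (τ * a z) := by push_cast; ring
      calc B * ‖b z - τ * a z‖ = ‖(B : ℂ) * (b z - τ * a z)‖ := by
            rw [norm_mul, Complex.norm_real, Real.norm_eq_abs, abs_of_nonneg hB0]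
        _ ≤ δ + |A - B| * ‖a z‖ := by
            rw [e]
            refine (norm_add_le _ _).trans ?_
            rw [norm_neg, norm_mul, hτa, Complex.norm_real, Real.norm_eq_abs]
            gcongr
    have h6 : |A - B| * ‖a z‖ ≤ δ := by
      have h7 : |A - B| * (A + B) ≤ δ := by
        rw [← abs_of_nonneg (add_nonneg hA0 hB0), ← abs_mul, abs_le]
        constructor <;> nlinarith
      refine le_trans ?_ h7
      gcongr
      linarith
    nlinarith
  · push Not at hcase
    have h5 : ‖b z - τ * a z‖ ≤ ‖b z‖ + ‖a z‖ := by
      refine (norm_sub_le _ _).trans ?_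
      rw [hτa]
    have h6 : A ^ 2 ≤ 4 / 3 * δ := by nlinarith
    have h7 : ‖b z‖ ^ 2 ≤ A ^ 2 + δ := by nlinarith [norm_nonneg (a z)]
    have h8 : ‖b z‖ * A ≤ 2 * δ := by nlinarith [sq_nonneg (‖b z‖ - A)]
    have h9 : ‖a z‖ * A ≤ 2 * δ := by nlinarith
    nlinarith

/-- There is a phase that, up to a factor `2`, is as close to every phase as `m` is. -/
lemma exists_circle_norm_sub_le (m : ℂ) :
    ∃ τ : Circle, ∀ u : Circle, ‖(u : ℂ) - τ‖ ≤ 2 * ‖(u : ℂ) - m‖ := by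
  obtain ⟨τ, hτ⟩ := exists_circle_norm_mul m
  refine ⟨τ, fun u => ?_⟩
  have h1 : ‖m - τ‖ ≤ ‖(u : ℂ) - m‖ := by
    have e : m - τ = ((‖m‖ - 1 : ℝ) : ℂ) * τ := by
      nth_rw 1 [hτ]
      push_cast; ring
    rw [e, norm_mul, Circle.norm_coe, mul_one, Complex.norm_real, Real.norm_eq_abs, abs_sub_comm]
    have := abs_norm_sub_norm_le (u : ℂ) m
    rwa [Circle.norm_coe] at this
  have := norm_add_le ((u : ℂ) - m) (m - τ)
  rw [sub_add_sub_cancel] at this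
  linarith

/-! ### Dirichlet form and Poincaré inequality of a weighted graph. -/

namespace WeightedGraph

variable {V : Type*} [Fintype V] [DecidableEq V]

lemma re_star_dotProduct_laplacian (G : WeightedGraph V) (z : V → ℂ) :
    (star z ⬝ᵥ (G.laplacian.map Complex.ofReal).mulVec z).re
      = 1 / 2 * ∑ u, ∑ v, (G.σ u v : ℝ) * ‖z u - z v‖ ^ 2 := by
  have hn : ∀ u v, (‖z u - z v‖ ^ 2 : ℝ)
      = ‖z u‖ ^ 2 + ‖z v‖ ^ 2 - 2 * (starRingEnd ℂ (z u) * z v).re := by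
    intro u v
    simp only [← Complex.normSq_eq_norm_sq, Complex.normSq_sub]
    congr 2
    rw [← Complex.conj_re, map_mul, Complex.conj_conj]
  have h1 : (star z ⬝ᵥ (G.laplacian.map Complex.ofReal).mulVec z).re
      = ∑ u, (G.degree u * ‖z u‖ ^ 2) - ∑ u, ∑ v, (G.σ u v : ℝ) * (starRingEnd ℂ (z u) * z v).re := by
    have e : ∀ u, (G.laplacian.map Complex.ofReal).mulVec z u
        = G.degree u * z u - ∑ v, (G.σ u v : ℂ) * z v := by
      intro u
      simp only [Matrix.mulVec, dotProduct, Matrix.map_apply, laplacian, Matrix.sub_apply,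
        adjacency, Matrix.of_apply, Complex.ofReal_sub, sub_mul, Finset.sum_sub_distrib]
      congr 1
      rw [Finset.sum_eq_single u]
      · simp
      · intro v _ hv
        rw [Matrix.diagonal_apply_ne _ hv.symm]; simp
      · simp
    simp only [dotProduct, e, Complex.re_sum, mul_sub, Complex.sub_re, Finset.sum_sub_distrib,
      Pi.star_apply]
    congr 1
    · refine Finset.sum_congr rfl fun u _ => ?_
      rw [mul_left_comm, Complex.re_ofReal_mul, RCLike.star_def,
        mul_comm (starRingEnd ℂ (z u)), Complex.mul_conj, Complex.ofReal_re,
        Complex.normSq_eq_norm_sq]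
    · refine Finset.sum_congr rfl fun u _ => ?_
      rw [Finset.mul_sum, Complex.re_sum]
      refine Finset.sum_congr rfl fun v _ => ?_
      rw [mul_left_comm, RCLike.star_def]
      exact Complex.re_ofReal_mul _ _
  have hsum : ∑ u, ∑ v, (G.σ u v : ℝ) * ‖z v‖ ^ 2 = ∑ v, G.degree v * ‖z v‖ ^ 2 := by
    rw [Finset.sum_comm]
    refine Finset.sum_congr rfl fun v _ => ?_
    simp only [degree, adjacency, Matrix.of_apply, Finset.sum_mul]
  have hsum' : ∑ u, ∑ v, (G.σ u v : ℝ) * ‖z u‖ ^ 2 = ∑ v, G.degree v * ‖z v‖ ^ 2 := by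
    refine Finset.sum_congr rfl fun v _ => ?_
    simp only [degree, adjacency, Matrix.of_apply, Finset.sum_mul, G.symm v]
  rw [h1]
  have h3 : ∑ u, ∑ v, (G.σ u v : ℝ) * ‖z u - z v‖ ^ 2
      = ∑ u, ∑ v, (G.σ u v : ℝ) * ‖z u‖ ^ 2 + ∑ u, ∑ v, (G.σ u v : ℝ) * ‖z v‖ ^ 2
        - 2 * ∑ u, ∑ v, (G.σ u v : ℝ) * (starRingEnd ℂ (z u) * z v).re := by
    simp only [Finset.mul_sum, ← Finset.sum_add_distrib, ← Finset.sum_sub_distrib, hn]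
    refine Finset.sum_congr rfl fun u _ => Finset.sum_congr rfl fun v _ => ?_
    ring
  rw [h3, hsum, hsum']
  ring

/-- The Poincaré inequality given by the algebraic connectivity. -/
lemma algebraicConnectivity_mul_le (G : WeightedGraph V) (hw : ∀ v, 0 < G.w v)
    (h0 : G.algebraicConnectivity ≠ 0) (z : V → ℂ)
    (hz : ∑ v, z v * (G.w v : ℂ) = 0) :
    ENNReal.ofReal (∑ v, ‖z v‖ ^ 2 * (G.w v : ℝ)) ≤ G.algebraicConnectivity⁻¹ *
      ENNReal.ofReal (1 / 2 * ∑ u, ∑ v, (G.σ u v : ℝ) * ‖z u - z v‖ ^ 2) := by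
  rcases eq_or_ne z 0 with rfl | hz0
  · simp
  set N := 1 / 2 * ∑ u, ∑ v, (G.σ u v : ℝ) * ‖z u - z v‖ ^ 2 with hN
  set D := ∑ v, ‖z v‖ ^ 2 * (G.w v : ℝ) with hD
  have hle : G.algebraicConnectivity ≤ ENNReal.ofReal (N / D) := by
    rw [hN, hD, ← re_star_dotProduct_laplacian]
    exact iInf_le_of_le z (iInf_le_of_le hz0 (iInf_le _ hz))
  have hD0 : 0 < D := by
    obtain ⟨v, hv⟩ := Function.ne_iff.1 hz0
    refine Finset.sum_pos' (fun v _ => by positivity) ⟨v, Finset.mem_univ _, ?_⟩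
    have h1 : 0 < ‖z v‖ := norm_pos_iff.2 hv
    have h2 : 0 < (G.w v : ℝ) := hw v
    positivity
  rw [ENNReal.ofReal_div_of_pos hD0] at hle
  have hDne : ENNReal.ofReal D ≠ 0 := by simpa using hD0
  have h1 : ENNReal.ofReal D * G.algebraicConnectivity ≤ ENNReal.ofReal N := by
    refine (mul_le_mul_right hle _).trans ?_
    rw [ENNReal.mul_div_cancel hDne ENNReal.ofReal_ne_top]
  -- A nonzero admissible `z` has finite Rayleigh quotient, since positive weights make the
  -- denominator positive.
  have htop : G.algebraicConnectivity ≠ ∞ :=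
    ne_top_of_le_ne_top (ENNReal.div_ne_top ENNReal.ofReal_ne_top hDne) hle
  rw [mul_comm, ← div_eq_mul_inv, ENNReal.le_div_iff_mul_le (Or.inl h0) (Or.inl htop)]
  exact h1

end WeightedGraph

/-! ### Extended norms as real integrals and pointwise bounds. -/

lemma eLpNorm_one_spectrogram {f : ℝ → ℂ} (hf : MemLp f 2 volume) {S : Set ℂ}
    (hS : IsCompact S) :
    eLpNorm (spectrogram f) 1 (volume.restrict S) = ENNReal.ofReal (∫ z in S, spectrogram f z) := by
  rw [eLpNorm_one_eq_lintegral_enorm, ← ofReal_integral_norm_eq_lintegral_enorm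
    ((continuous_spectrogram hf).continuousOn.integrableOn_compact hS)]
  congr 2
  ext z
  exact Real.norm_of_nonneg (sq_nonneg _)

lemma eLpNorm_two_eq_sqrt {E : Type*} [NormedAddCommGroup E] {h : ℂ → E} (hh : Continuous h)
    {S : Set ℂ} (hS : IsCompact S) :
    eLpNorm h 2 (volume.restrict S) = ENNReal.ofReal (√(∫ z in S, ‖h z‖ ^ 2)) := by
  have : Fact (volume S < ∞) := ⟨hS.measure_lt_top⟩
  have hm : MemLp h 2 (volume.restrict S) := by
    obtain ⟨B, hB⟩ := hS.exists_bound_of_continuousOn hh.continuousOn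
    exact MemLp.of_bound (hh.continuousOn.aestronglyMeasurable_of_isCompact hS hS.measurableSet) B
      (ae_restrict_of_forall_mem hS.measurableSet hB)
  rw [hm.eLpNorm_eq_integral_rpow_norm (by norm_num) (by norm_num), Real.sqrt_eq_rpow]
  norm_num

/-- Continuity upgrades the essential supremum to a pointwise bound: an open null set is empty. -/
lemma le_toReal_eLpNorm_top {h : ℂ → ℝ} (hc : Continuous h) (h0 : ∀ z, 0 ≤ h z) {B : ℝ}
    (hB : ∀ z, h z ≤ B) :
    eLpNorm h ∞ volume ≠ ∞ ∧ ∀ z, h z ≤ (eLpNorm h ∞ volume).toReal := by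
  have hfin : eLpNorm h ∞ volume ≠ ∞ := by
    rw [eLpNorm_exponent_top]
    refine (eLpNormEssSup_lt_top_of_ae_bound (C := B) (Filter.Eventually.of_forall fun z => ?_)).ne
    rw [Real.norm_of_nonneg (h0 z)]
    exact hB z
  refine ⟨hfin, fun z => ?_⟩
  by_contra! hz
  have hopen : IsOpen {z | (eLpNorm h ∞ volume).toReal < h z} := isOpen_lt continuous_const hc
  have hnull : volume {z | (eLpNorm h ∞ volume).toReal < h z} = 0 := by
    have := ae_le_eLpNormEssSup (f := h) (μ := (volume : Measure ℂ))
    rw [← eLpNorm_exponent_top] at this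
    rw [← compl_mem_ae_iff]
    filter_upwards [this] with w hw
    simp only [Set.mem_compl_iff, Set.mem_ofPred_eq, not_lt]
    rw [Real.enorm_of_nonneg (h0 w)] at hw
    exact (ENNReal.ofReal_le_iff_le_toReal hfin).1 hw
  rw [hopen.measure_eq_zero_iff (μ := volume)] at hnull
  exact hnull.subset hz

lemma constK_ne_top_and_le {f g : ℝ → ℂ} (hf : MemLp f 2 volume) (hg : MemLp g 2 volume) :
    constK f g ≠ ∞ ∧ ∀ z, spectrogram f z + spectrogram g z ≤ (constK f g).toReal := by
  obtain ⟨B, hB⟩ := exists_spectrogram_le hf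
  obtain ⟨B', hB'⟩ := exists_spectrogram_le hg
  have h1 := le_toReal_eLpNorm_top (continuous_spectrogram hf) (fun _ => sq_nonneg _) hB
  have h2 := le_toReal_eLpNorm_top (continuous_spectrogram hg) (fun _ => sq_nonneg _) hB'
  refine ⟨ENNReal.add_ne_top.2 ⟨h1.1, h2.1⟩, fun z => ?_⟩
  rw [constK, ENNReal.toReal_add h1.1 h2.1]
  exact add_le_add (h1.2 z) (h2.2 z)

/-! ### Local phases, and uniqueness up to a phase. -/

lemma exists_phase_on_unitSquare : ∃ C : ℝ, 1 ≤ C ∧ ∀ f g : ℝ → ℂ, MemLp f 2 volume →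
    MemLp g 2 volume → ∀ K : ℝ, (∀ z, spectrogram f z + spectrogram g z ≤ K) →
    ∀ Q, IsUnitSquare Q → ∃ τ : Circle, ∀ z ∈ Q, ∀ z' ∈ Q,
      ‖gabor g z - τ * gabor f z‖ ^ 2 * spectrogram f z'
        ≤ C * K * ∫ z in Q, |spectrogram f z - spectrogram g z| := by
  obtain ⟨C, hC, h⟩ := exists_kernel_bound
  refine ⟨16 * C, by linarith, fun f g hf hg K hK Q hQ => ?_⟩
  have hK0 : 0 ≤ K := (add_nonneg (sq_nonneg _) (sq_nonneg _)).trans (hK 0)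
  have hI : 0 ≤ ∫ z in Q, |spectrogram f z - spectrogram g z| :=
    integral_nonneg fun _ => abs_nonneg _
  obtain ⟨τ, hτ⟩ := exists_phase_of_kernel_le hQ.isCompact (continuous_gabor hf).continuousOn
    (fun z hz z' hz' => Real.le_sqrt_of_sq_le (h f g hf hg K hK Q hQ z hz z' hz'))
  refine ⟨τ, fun z hz z' hz' => ?_⟩
  have h1 := pow_le_pow_left₀ (by positivity) (hτ z hz z' hz') 2
  rw [mul_pow, mul_pow, Real.sq_sqrt (by positivity)] at h1
  rw [spectrogram]
  linarith

/-- Signals whose spectrograms agree on a unit square agree up to a phase. -/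
lemma exists_gabor_eq_of_integral_eq_zero {f g : ℝ → ℂ} (hf : MemLp f 2 volume)
    (hg : MemLp g 2 volume) {Q : Set ℂ} (hQ : IsUnitSquare Q)
    (h : ∫ z in Q, |spectrogram f z - spectrogram g z| = 0) :
    ∃ τ : Circle, ∀ z, gabor g z = τ * gabor f z := by
  obtain ⟨C, -, hC⟩ := exists_phase_on_unitSquare
  obtain ⟨C', -, hC'⟩ := exists_kernel_bound
  obtain ⟨-, hK⟩ := constK_ne_top_and_le hf hg
  obtain ⟨τ, hτ⟩ := hC f g hf hg _ hK Q hQ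
  have hker := hC' f g hf hg _ hK Q hQ
  simp only [h, mul_zero] at hτ hker
  have hzero : ∀ z ∈ Q, gabor g z = τ * gabor f z := by
    intro z hz
    -- If `gabor f` vanishes on the whole square, the phase estimate says nothing, and the diagonal
    -- of the kernel estimate gives `gabor g = 0` there.
    by_cases hex : ∃ z' ∈ Q, gabor f z' ≠ 0
    · obtain ⟨z', hz', hne⟩ := hex
      have h1 : 0 < spectrogram f z' := pow_pos (norm_pos_iff.2 hne) 2
      have h2 : ‖gabor g z - τ * gabor f z‖ ^ 2 = 0 :=
        le_antisymm (nonpos_of_mul_nonpos_left (hτ z hz z' hz') h1) (sq_nonneg _)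
      exact sub_eq_zero.1 (norm_eq_zero.1 (pow_eq_zero_iff two_ne_zero |>.1 h2))
    · push Not at hex
      have h1 := le_antisymm (hker z hz z hz) (sq_nonneg _)
      rw [hex z hz, pow_eq_zero_iff two_ne_zero, norm_eq_zero, zero_mul, zero_sub, neg_eq_zero,
        Complex.mul_conj, Complex.ofReal_eq_zero, Complex.normSq_eq_zero] at h1
      rw [h1, hex z hz, mul_zero]
  refine ⟨τ, fun z => ?_⟩
  obtain ⟨c, hc⟩ := hQ.exists_mem_nhds
  have hFd := differentiable_bargmann (memLp_conj hf)
  have hGd := differentiable_bargmann (memLp_conj hg)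
  have heq : bargmann (fun t => starRingEnd ℂ (g t)) = fun z =>
      starRingEnd ℂ (τ : ℂ) * bargmann (fun t => starRingEnd ℂ (f t)) z := by
    -- The square contains an open set, so the identity theorem extends the relation to the plane.
    refine AnalyticOnNhd.eq_of_eventuallyEq (z₀ := c) (𝕜 := ℂ)
      (fun z _ => hGd.analyticAt z) (fun z _ => (hFd.const_mul _).analyticAt z) ?_
    filter_upwards [hc] with v hv
    have h1 := congrArg (starRingEnd ℂ) (hzero v hv)
    rw [map_mul, conj_gabor, conj_gabor, mul_left_comm] at h1
    exact mul_left_cancel₀ (Complex.exp_ne_zero _) h1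
  have h1 : starRingEnd ℂ (gabor g z) = starRingEnd ℂ (τ * gabor f z) := by
    rw [map_mul, conj_gabor, conj_gabor, heq, mul_left_comm]
  exact (starRingEnd ℂ).injective h1

/-! ### Sums over overlapping squares, and dependence on the phase. -/

lemma sq_setIntegral_le {Q : Set ℂ} (hQ : IsUnitSquare Q) {d : ℂ → ℝ} (hd : Continuous d) :
    (∫ z in Q, d z) ^ 2 ≤ ∫ z in Q, d z ^ 2 := by
  have : IsProbabilityMeasure (volume.restrict Q) :=
    ⟨by rw [Measure.restrict_apply_univ, hQ.volume_eq_one]⟩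
  exact (even_two.convexOn_pow (𝕜 := ℝ)).map_integral_le (continuousOn_id.pow 2) isClosed_univ
    (Filter.Eventually.of_forall fun _ => Set.mem_univ _)
    (hd.continuousOn.integrableOn_compact hQ.isCompact)
    ((hd.pow 2).continuousOn.integrableOn_compact hQ.isCompact)

lemma constL_ne_top {V : Type*} [Fintype V] (Q : V → Set ℂ) : constL Q ≠ ∞ := by
  rw [constL, eLpNorm_exponent_top]
  refine (eLpNormEssSup_lt_top_of_ae_bound (C := ∑ _v : V, (1 : ℝ))
    (Filter.Eventually.of_forall fun z => ?_)).ne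
  refine (norm_sum_le _ _).trans (Finset.sum_le_sum fun v _ => ?_)
  exact (norm_indicator_le_norm_self _ _).trans (by simp)

lemma ae_sum_indicator_le_constL {V : Type*} [Fintype V] (Q : V → Set ℂ) :
    ∀ᵐ z : ℂ, ∑ v, (Q v).indicator (fun _ => (1 : ℝ)) z ≤ (constL Q).toReal := by
  have := ae_le_eLpNormEssSup (f := fun z : ℂ => ∑ v, (Q v).indicator (fun _ => (1 : ℝ)) z)
    (μ := (volume : Measure ℂ))
  rw [← eLpNorm_exponent_top] at this
  filter_upwards [this] with z hz
  rw [Real.enorm_of_nonneg (Finset.sum_nonneg fun v _ =>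
    Set.indicator_nonneg (fun _ _ => zero_le_one) _)] at hz
  exact (ENNReal.ofReal_le_iff_le_toReal (constL_ne_top Q)).1 hz

lemma isCompact_iUnion_unitSquare {V : Type*} [Finite V] {Q : V → Set ℂ}
    (hQ : ∀ v, IsUnitSquare (Q v)) : IsCompact (⋃ v, Q v) :=
  isCompact_iUnion fun v => (hQ v).isCompact

lemma sum_setIntegral_le_constL_mul {V : Type*} [Fintype V] {Q : V → Set ℂ}
    (hQ : ∀ v, IsUnitSquare (Q v)) {d : ℂ → ℝ} (hd : Continuous d) (hd0 : ∀ z, 0 ≤ d z) :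
    ∑ v, ∫ z in Q v, d z ≤ (constL Q).toReal * ∫ z in ⋃ v, Q v, d z := by
  have hΩ := isCompact_iUnion_unitSquare hQ
  have hi : ∀ S : Set ℂ, IsCompact S → Integrable (S.indicator d) := fun S hS =>
    (hd.continuousOn.integrableOn_compact hS).integrable_indicator hS.measurableSet
  simp only [← integral_indicator (hQ _).measurableSet, ← integral_indicator hΩ.measurableSet]
  rw [← integral_finsetSum _ fun v _ => hi _ (hQ v).isCompact, ← integral_const_mul]
  refine integral_mono_ae (integrable_finsetSum _ fun v _ => hi _ (hQ v).isCompact)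
    ((hi _ hΩ).const_mul _) ?_
  filter_upwards [ae_sum_indicator_le_constL Q] with z hz
  by_cases hzΩ : z ∈ ⋃ v, Q v
  · rw [Set.indicator_of_mem hzΩ]
    refine le_trans (le_of_eq ?_) (mul_le_mul_of_nonneg_right hz (hd0 z))
    rw [Finset.sum_mul]
    refine Finset.sum_congr rfl fun v _ => ?_
    by_cases hv : z ∈ Q v <;> simp [hv]
  · rw [Set.indicator_of_notMem hzΩ, mul_zero]
    refine le_of_eq (Finset.sum_eq_zero fun v _ => Set.indicator_of_notMem (fun hv => hzΩ ?_) _)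
    exact Set.mem_iUnion.2 ⟨v, hv⟩

lemma setIntegral_iUnion_le_sum {V : Type*} [Fintype V] {Q : V → Set ℂ}
    (hQ : ∀ v, IsUnitSquare (Q v)) {d : ℂ → ℝ} (hd : Continuous d) (hd0 : ∀ z, 0 ≤ d z) :
    ∫ z in ⋃ v, Q v, d z ≤ ∑ v, ∫ z in Q v, d z := by
  have hΩ := isCompact_iUnion_unitSquare hQ
  have hi : ∀ S : Set ℂ, IsCompact S → Integrable (S.indicator d) := fun S hS =>
    (hd.continuousOn.integrableOn_compact hS).integrable_indicator hS.measurableSet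
  simp only [← integral_indicator (hQ _).measurableSet, ← integral_indicator hΩ.measurableSet]
  rw [← integral_finsetSum _ fun v _ => hi _ (hQ v).isCompact]
  refine integral_mono (hi _ hΩ) (integrable_finsetSum _ fun v _ => hi _ (hQ v).isCompact)
    fun z => ?_
  have h0 : ∀ v, 0 ≤ (Q v).indicator d z := fun v => Set.indicator_nonneg (fun _ _ => hd0 _) _
  by_cases hzΩ : z ∈ ⋃ v, Q v
  · obtain ⟨v, hv⟩ := Set.mem_iUnion.1 hzΩ
    rw [Set.indicator_of_mem hzΩ, ← Set.indicator_of_mem hv d]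
    exact Finset.single_le_sum (f := fun v => (Q v).indicator d z) (fun v _ => h0 v)
      (Finset.mem_univ v)
  · rw [Set.indicator_of_notMem hzΩ]
    exact Finset.sum_nonneg fun v _ => h0 v

lemma setIntegral_le_of_forall_le {S : Set ℂ} (hS : IsCompact S) (hS1 : volume S ≤ 1) {d : ℂ → ℝ}
    (hd : Continuous d) {D : ℝ} (hD : 0 ≤ D) (h : ∀ z ∈ S, d z ≤ D) : ∫ z in S, d z ≤ D := by
  have h1 := setIntegral_mono_on (hd.continuousOn.integrableOn_compact (μ := volume) hS)
    (continuous_const.continuousOn.integrableOn_compact (f := fun _ => D) hS) hS.measurableSet h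
  rw [setIntegral_const, smul_eq_mul] at h1
  refine h1.trans (mul_le_of_le_one_left hD ?_)
  exact ENNReal.toReal_le_of_le_ofReal zero_le_one (by simpa using hS1)

lemma continuous_eLpNorm_phase {f g : ℝ → ℂ} (hf : MemLp f 2 volume) (hg : MemLp g 2 volume)
    {S : Set ℂ} (hS : IsCompact S) :
    Continuous fun τ : Circle =>
      eLpNorm (fun z : ℂ => gabor g z - (τ : ℂ) * gabor f z) 2 (volume.restrict S) := by
  have hcf := continuous_gabor hf
  have hcg := continuous_gabor hg
  have h : ∀ τ : Circle, Continuous fun z : ℂ => gabor g z - (τ : ℂ) * gabor f z := fun τ => by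
    fun_prop
  simp only [eLpNorm_two_eq_sqrt (h _) hS]
  refine ENNReal.continuous_ofReal.comp (Real.continuous_sqrt.comp ?_)
  refine continuous_parametric_integral_of_continuous (μ := volume)
    (f := fun (τ : Circle) z => ‖gabor g z - (τ : ℂ) * gabor f z‖ ^ 2) ?_ hS
  simp only [Function.uncurry_def]
  fun_prop

/-- Integrates a two-point bound in both points; since the volume is at most 1, no constant is lost.
-/
lemma setIntegral_mul_setIntegral_le {S : Set ℂ} (hS : IsCompact S) (hS1 : volume S ≤ 1)
    {p q : ℂ → ℝ} (hp : Continuous p) (hq : Continuous q) {D : ℝ} (hD : 0 ≤ D)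
    (h : ∀ z ∈ S, ∀ z' ∈ S, p z * q z' ≤ D) : (∫ z in S, p z) * ∫ z in S, q z ≤ D := by
  rw [← integral_const_mul]
  refine setIntegral_le_of_forall_le hS hS1 (by fun_prop) hD fun z' hz' => ?_
  rw [← integral_mul_const]
  exact setIntegral_le_of_forall_le hS hS1 (by fun_prop) hD fun z hz => h z hz z' hz'

lemma norm_add_sq_le_two_mul (x y : ℂ) : ‖x + y‖ ^ 2 ≤ 2 * ‖x‖ ^ 2 + 2 * ‖y‖ ^ 2 := by
  have := pow_le_pow_left₀ (norm_nonneg _) (norm_add_le x y) 2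
  nlinarith [sq_nonneg (‖x‖ - ‖y‖)]

/-! ### Gluing the local phases. -/

variable {f g : ℝ → ℂ}

lemma coe_signalGraph_w (hf : MemLp f 2 volume) {V : Type*} {Q : V → Set ℂ}
    (hQ : ∀ v, IsUnitSquare (Q v)) (v : V) :
    ((signalGraph f Q).w v : ℝ) = ∫ z in Q v, spectrogram f z := by
  simp only [signalGraph, eLpNorm_one_spectrogram hf (hQ v).isCompact]
  exact ENNReal.toReal_ofReal (integral_nonneg fun _ => sq_nonneg _)

lemma coe_signalGraph_σ (hf : MemLp f 2 volume) {V : Type*} {Q : V → Set ℂ}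
    (hQ : ∀ v, IsUnitSquare (Q v)) (u v : V) :
    ((signalGraph f Q).σ u v : ℝ) = (∫ z in Q u ∩ Q v, spectrogram f z) ^ 2 := by
  simp only [signalGraph, NNReal.coe_pow, eLpNorm_one_spectrogram hf
    ((hQ u).isCompact.inter (hQ v).isCompact)]
  congr 1
  exact ENNReal.toReal_ofReal (integral_nonneg fun _ => sq_nonneg _)

/-- Phases that are good on two squares are close if the squares share much of the energy. -/
lemma sq_setIntegral_inter_mul_norm_sub_le (hf : MemLp f 2 volume) {Q Q' : Set ℂ}
    (hQ : IsUnitSquare Q) (hQ' : IsUnitSquare Q') {τ τ' : Circle} {D D' : ℝ} (hD : 0 ≤ D)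
    (hD' : 0 ≤ D')
    (h : ∀ z ∈ Q, ∀ z' ∈ Q, ‖gabor g z - τ * gabor f z‖ ^ 2 * spectrogram f z' ≤ D)
    (h' : ∀ z ∈ Q', ∀ z' ∈ Q', ‖gabor g z - τ' * gabor f z‖ ^ 2 * spectrogram f z' ≤ D') :
    (∫ z in Q ∩ Q', spectrogram f z) ^ 2 * ‖(τ : ℂ) - τ'‖ ^ 2 ≤ 2 * D + 2 * D' := by
  have hc := continuous_spectrogram hf
  -- One factor of the shared energy comes from the point where phases are compared, the other from
  -- the second point `z'` of the local estimates. This is why `σ` is a squared norm.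
  have key := setIntegral_mul_setIntegral_le (hQ.isCompact.inter hQ'.isCompact)
    ((measure_mono Set.inter_subset_left).trans_eq hQ.volume_eq_one)
    (p := fun z => ‖(τ : ℂ) - τ'‖ ^ 2 * spectrogram f z) (q := spectrogram f) (by fun_prop) hc
    (D := 2 * D + 2 * D') (by positivity) fun z hz z' hz' => by
      have h1 : ‖(τ : ℂ) - τ'‖ ^ 2 * spectrogram f z
          ≤ 2 * ‖gabor g z - τ' * gabor f z‖ ^ 2 + 2 * ‖gabor g z - τ * gabor f z‖ ^ 2 := by
        have e : ((τ : ℂ) - τ') * gabor f z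
            = (gabor g z - τ' * gabor f z) + -(gabor g z - τ * gabor f z) := by ring
        rw [spectrogram, ← mul_pow, ← norm_mul, e]
        refine (norm_add_sq_le_two_mul _ _).trans ?_
        rw [norm_neg]
      have h2 : 0 ≤ spectrogram f z' := sq_nonneg _
      have h3 := mul_le_mul_of_nonneg_right h1 h2
      have h4 := h z hz.1 z' hz'.1
      have h5 := h' z hz.2 z' hz'.2
      linarith
  rw [integral_const_mul] at key
  linarith

/-- The distance to a global phase, in terms of local phases. -/
lemma setIntegral_iUnion_norm_sub_le (hf : MemLp f 2 volume) (hg : MemLp g 2 volume)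
    {V : Type*} [Fintype V] {Q : V → Set ℂ}
    (hQ : ∀ v, IsUnitSquare (Q v)) {τ : V → Circle} {D : V → ℝ} (hD0 : ∀ v, 0 ≤ D v)
    (hw : ∀ v, 0 < ∫ z in Q v, spectrogram f z)
    (h : ∀ v, ∀ z ∈ Q v, ∀ z' ∈ Q v,
      ‖gabor g z - τ v * gabor f z‖ ^ 2 * spectrogram f z' ≤ D v) (τ₀ : Circle) :
    ∫ z in ⋃ v, Q v, ‖gabor g z - τ₀ * gabor f z‖ ^ 2
      ≤ 2 * ∑ v, D v * (∫ z in Q v, spectrogram f z)⁻¹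
        + 2 * ∑ v, ‖(τ v : ℂ) - τ₀‖ ^ 2 * ∫ z in Q v, spectrogram f z := by
  have hcf := continuous_gabor hf
  have hcg := continuous_gabor hg
  have hc := continuous_spectrogram hf
  refine (setIntegral_iUnion_le_sum hQ (by fun_prop) fun _ => sq_nonneg _).trans ?_
  rw [Finset.mul_sum, Finset.mul_sum, ← Finset.sum_add_distrib]
  refine Finset.sum_le_sum fun v _ => ?_
  have hi : ∀ d : ℂ → ℝ, Continuous d → IntegrableOn d (Q v) := fun d hd =>
    hd.continuousOn.integrableOn_compact (hQ v).isCompact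
  have h1 : ∫ z in Q v, ‖gabor g z - τ₀ * gabor f z‖ ^ 2
      ≤ ∫ z in Q v, (2 * ‖gabor g z - τ v * gabor f z‖ ^ 2
        + 2 * (‖(τ v : ℂ) - τ₀‖ ^ 2 * spectrogram f z)) := by
    refine integral_mono (hi _ (by fun_prop)) (hi _ (by fun_prop)) fun z => ?_
    have e : gabor g z - τ₀ * gabor f z
        = (gabor g z - τ v * gabor f z) + ((τ v : ℂ) - τ₀) * gabor f z := by ring
    simp only [spectrogram]
    rw [← mul_pow, ← norm_mul, e]
    exact norm_add_sq_le_two_mul _ _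
  rw [integral_add (hi _ (by fun_prop)) (hi _ (by fun_prop)), integral_const_mul,
    integral_const_mul, integral_const_mul] at h1
  have h2 := setIntegral_mul_setIntegral_le (hQ v).isCompact (hQ v).volume_eq_one.le
    (p := fun z => ‖gabor g z - τ v * gabor f z‖ ^ 2) (by fun_prop) hc (hD0 v) (h v)
  rw [← le_mul_inv_iff₀ (hw v)] at h2
  linarith

lemma ofReal_sqrt (x : ℝ) (hx : 0 ≤ x) : ENNReal.ofReal (√x) = ENNReal.ofReal x ^ (1 / 2 : ℝ) := by
  rw [Real.sqrt_eq_rpow, ENNReal.ofReal_rpow_of_nonneg hx (by norm_num)]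

/-- The main estimate, squared, in the nondegenerate case. -/
lemma exists_main_bound : ∃ C : ℝ, 1 ≤ C ∧ ∀ f g : ℝ → ℂ, MemLp f 2 volume → MemLp g 2 volume →
    ∀ (ν : ℕ) (Q : Fin ν → Set ℂ), (∀ v, IsUnitSquare (Q v)) →
    (∀ v, 0 < ∫ z in Q v, spectrogram f z) → (signalGraph f Q).algebraicConnectivity ≠ 0 →
    ∃ τ : Circle, ENNReal.ofReal (∫ z in ⋃ v, Q v, ‖gabor g z - τ * gabor f z‖ ^ 2) ≤
      ENNReal.ofReal C * ((constK f g * constM f Q ^ (1 / 2 : ℝ) * constL Q ^ (1 / 2 : ℝ)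
        + (signalGraph f Q).algebraicConnectivity⁻¹ * constK f g * (ν : ℝ≥0∞) ^ (3 / 2 : ℝ)
          * constL Q ^ (1 / 2 : ℝ)) *
        eLpNorm (fun z : ℂ => spectrogram f z - spectrogram g z) 2
          (volume.restrict (⋃ i, Q i))) := by
  obtain ⟨C, hC, hphase⟩ := exists_phase_on_unitSquare
  refine ⟨16 * C, by linarith, fun f g hf hg ν Q hQ hw hconn => ?_⟩
  obtain ⟨hKtop, hK⟩ := constK_ne_top_and_le hf hg
  set K := (constK f g).toReal with hKdef
  have hK0 : 0 ≤ K := ENNReal.toReal_nonneg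
  choose τ hτ using fun v => hphase f g hf hg K hK (Q v) (hQ v)
  set w : Fin ν → ℝ := fun v => ∫ z in Q v, spectrogram f z with hwdef
  set e : Fin ν → ℝ := fun v => ∫ z in Q v, |spectrogram f z - spectrogram g z| with hedef
  have he0 : ∀ v, 0 ≤ e v := fun v => integral_nonneg fun _ => abs_nonneg _
  have hD0 : ∀ v, 0 ≤ C * K * e v := fun v => by have := he0 v; positivity
  have hcd : Continuous fun z => spectrogram f z - spectrogram g z :=
    (continuous_spectrogram hf).sub (continuous_spectrogram hg)
  have hΩ := isCompact_iUnion_unitSquare hQ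
  set I : ℝ := ∫ z in ⋃ v, Q v, ‖spectrogram f z - spectrogram g z‖ ^ 2 with hI
  have hI0 : 0 ≤ I := integral_nonneg fun _ => sq_nonneg _
  set L := (constL Q).toReal with hL
  have hL0 : 0 ≤ L := ENNReal.toReal_nonneg
  have hsum_e : ∑ v, e v ^ 2 ≤ L * I :=
    (Finset.sum_le_sum fun v _ => sq_setIntegral_le (hQ v) hcd.abs).trans
      (sum_setIntegral_le_constL_mul hQ (hcd.norm.pow 2) fun _ => sq_nonneg _)
  set M := ∑ v, (w v ^ 2)⁻¹ with hM
  have hM0 : 0 ≤ M := Finset.sum_nonneg fun v _ => by positivity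
  -- Subtracting the `w`-weighted mean makes `τ - m` orthogonal to constants, as the Poincaré
  -- inequality requires.
  set m : ℂ := (∑ v, (w v : ℂ) * τ v) / ∑ v, (w v : ℂ) with hm
  obtain ⟨τ₀, hτ₀⟩ := exists_circle_norm_sub_le m
  refine ⟨τ₀, ?_⟩
  have hstep := setIntegral_iUnion_norm_sub_le hf hg hQ hD0 hw hτ τ₀
  -- Cauchy–Schwarz separates `∑ (w v)⁻²`, which is `M`, from `∑ (e v)² ≤ L I`.
  have hloc : ∑ v, C * K * e v * (w v)⁻¹ ≤ C * (K * √M * √L * √I) := by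
    have h1 := Finset.sum_mul_sq_le_sq_mul_sq Finset.univ e fun v => (w v)⁻¹
    have h2 : ∑ v, e v * (w v)⁻¹ ≤ √(L * I * M) := by
      refine Real.le_sqrt_of_sq_le (h1.trans ?_)
      simp only [inv_pow]
      gcongr
    rw [Real.sqrt_mul (by positivity), Real.sqrt_mul hL0] at h2
    calc ∑ v, C * K * e v * (w v)⁻¹ = C * K * ∑ v, e v * (w v)⁻¹ := by
          rw [Finset.mul_sum]; exact Finset.sum_congr rfl fun v _ => by ring
      _ ≤ C * K * (√L * √I * √M) := by gcongr
      _ = _ := by ring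
  have hz : ∑ v, ((τ v : ℂ) - m) * ((signalGraph f Q).w v : ℂ) = 0 := by
    have hwc : ∀ v, ((signalGraph f Q).w v : ℂ) = (w v : ℂ) := fun v => by
      rw [coe_signalGraph_w hf hQ]
    simp only [hwc, sub_mul, Finset.sum_sub_distrib, ← Finset.mul_sum]
    rcases isEmpty_or_nonempty (Fin ν) with hemp | hne
    · simp
    · have hpos : 0 < ∑ v, w v := Finset.sum_pos (fun v _ => hw v) Finset.univ_nonempty
      have hne0 : ∑ v, (w v : ℂ) ≠ 0 := by
        rw [← Complex.ofReal_sum]; exact_mod_cast hpos.ne'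
      rw [hm, div_mul_cancel₀ _ hne0, sub_eq_zero]
      exact Finset.sum_congr rfl fun v _ => mul_comm _ _
  have hpoinc := (signalGraph f Q).algebraicConnectivity_mul_le
    (fun v => by
      have := hw v
      rw [← NNReal.coe_pos, coe_signalGraph_w hf hQ]; exact this) hconn _ hz
  simp only [coe_signalGraph_w hf hQ, coe_signalGraph_σ hf hQ, sub_sub_sub_cancel_right] at hpoinc
  have hedge : 1 / 2 * ∑ u, ∑ v, (∫ z in Q u ∩ Q v, spectrogram f z) ^ 2 * ‖(τ u : ℂ) - τ v‖ ^ 2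
      ≤ 2 * C * (K * (ν : ℝ) ^ (3 / 2 : ℝ) * √L * √I) := by
    have h1 : ∑ u, ∑ v, (∫ z in Q u ∩ Q v, spectrogram f z) ^ 2 * ‖(τ u : ℂ) - τ v‖ ^ 2
        ≤ ∑ u, ∑ v, (2 * (C * K * e u) + 2 * (C * K * e v)) :=
      Finset.sum_le_sum fun u _ => Finset.sum_le_sum fun v _ =>
        sq_setIntegral_inter_mul_norm_sub_le hf (hQ u) (hQ v) (hD0 u) (hD0 v) (hτ u) (hτ v)
    have h2 : ∑ u, ∑ v, (2 * (C * K * e u) + 2 * (C * K * e v)) = 4 * C * K * ν * ∑ v, e v := by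
      simp only [Finset.sum_add_distrib, Finset.sum_const, Finset.card_univ, Fintype.card_fin,
        nsmul_eq_mul, ← Finset.mul_sum]
      ring
    -- Cauchy–Schwarz costs `√ν`. With the factor `ν` from the double sum this yields `ν^(3/2)`.
    have h3 : ∑ v, e v ≤ √ν * (√L * √I) := by
      rw [← Real.sqrt_mul hL0, ← Real.sqrt_mul (Nat.cast_nonneg _)]
      refine Real.le_sqrt_of_sq_le ?_
      have := sq_sum_le_card_mul_sum_sq (s := Finset.univ) (f := e)
      rw [Finset.card_univ, Fintype.card_fin] at this
      refine this.trans ?_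
      gcongr
    have h4 : (ν : ℝ) ^ (3 / 2 : ℝ) = ν * √ν := by
      rw [Real.sqrt_eq_rpow, show (3 / 2 : ℝ) = 1 + 1 / 2 by norm_num,
        Real.rpow_add_of_nonneg (Nat.cast_nonneg _) (by norm_num) (by norm_num), Real.rpow_one]
    rw [h2] at h1
    calc _ ≤ 1 / 2 * (4 * C * K * ν * (√ν * (√L * √I))) := by gcongr; exact h1.trans (by gcongr)
      _ = _ := by rw [h4]; ring
  have hglob : ∑ v, ‖(τ v : ℂ) - τ₀‖ ^ 2 * w v ≤ 4 * ∑ v, ‖(τ v : ℂ) - m‖ ^ 2 * w v := by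
    rw [Finset.mul_sum]
    refine Finset.sum_le_sum fun v _ => ?_
    have h1 := pow_le_pow_left₀ (norm_nonneg _) (hτ₀ (τ v)) 2
    have h2 := mul_le_mul_of_nonneg_right h1 (hw v).le
    linarith
  set G := ∑ v, ‖(τ v : ℂ) - m‖ ^ 2 * w v with hG
  have htotal : ∫ z in ⋃ v, Q v, ‖gabor g z - τ₀ * gabor f z‖ ^ 2
      ≤ 2 * C * (K * √M * √L * √I) + 8 * G := by linarith
  have hEK : constK f g = ENNReal.ofReal K := (ENNReal.ofReal_toReal hKtop).symm
  have hEL : constL Q ^ (1 / 2 : ℝ) = ENNReal.ofReal (√L) := by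
    rw [ofReal_sqrt _ hL0, ENNReal.ofReal_toReal (constL_ne_top Q)]
  have hEM : constM f Q ^ (1 / 2 : ℝ) = ENNReal.ofReal (√M) := by
    rw [ofReal_sqrt _ hM0, hM, ENNReal.ofReal_sum_of_nonneg fun v _ => by positivity, constM]
    congr 1
    refine Finset.sum_congr rfl fun v _ => ?_
    rw [eLpNorm_one_spectrogram hf (hQ v).isCompact,
      ENNReal.ofReal_inv_of_pos (pow_pos (hw v) 2), ENNReal.ofReal_pow (hw v).le]
  have hEI : eLpNorm (fun z : ℂ => spectrogram f z - spectrogram g z) 2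
      (volume.restrict (⋃ i, Q i)) = ENNReal.ofReal (√I) := eLpNorm_two_eq_sqrt hcd hΩ
  have hEν : (ν : ℝ≥0∞) ^ (3 / 2 : ℝ) = ENNReal.ofReal ((ν : ℝ) ^ (3 / 2 : ℝ)) := by
    rw [← ENNReal.ofReal_rpow_of_nonneg (Nat.cast_nonneg _) (by norm_num), ENNReal.ofReal_natCast]
  rw [hEK, hEL, hEM, hEI, hEν]
  set l := (signalGraph f Q).algebraicConnectivity⁻¹ with hl
  have hG2 : ENNReal.ofReal G ≤ l * ENNReal.ofReal
      (2 * C * (K * (ν : ℝ) ^ (3 / 2 : ℝ) * √L * √I)) := hpoinc.trans (by gcongr)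
  have hC0 : 0 ≤ C := by linarith
  refine (ENNReal.ofReal_le_ofReal htotal).trans ?_
  refine ENNReal.ofReal_add_le.trans ?_
  calc ENNReal.ofReal (2 * C * (K * √M * √L * √I)) + ENNReal.ofReal (8 * G)
      ≤ ENNReal.ofReal (16 * C * (K * √M * √L * √I)) + ENNReal.ofReal 8 * (l * ENNReal.ofReal
        (2 * C * (K * (ν : ℝ) ^ (3 / 2 : ℝ) * √L * √I))) := by
        rw [ENNReal.ofReal_mul (by norm_num : (0 : ℝ) ≤ 8)]
        gcongr
        norm_num
    _ = _ := by
        have hprod : ∀ c a : ℝ, 0 ≤ c → 0 ≤ a → ENNReal.ofReal (c * (K * a * √L * √I))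
            = ENNReal.ofReal c * (ENNReal.ofReal K * ENNReal.ofReal a * ENNReal.ofReal (√L)
              * ENNReal.ofReal (√I)) := fun c a hc ha => by
          rw [ENNReal.ofReal_mul hc, ENNReal.ofReal_mul (by positivity),
            ENNReal.ofReal_mul (by positivity), ENNReal.ofReal_mul hK0]
        have h16 : ENNReal.ofReal (16 * C) = ENNReal.ofReal 8 * ENNReal.ofReal (2 * C) := by
          rw [← ENNReal.ofReal_mul (by norm_num)]; congr 1; ring
        rw [hprod _ _ (by positivity) (by positivity), hprod _ _ (by positivity) (by positivity),
          h16]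
        ring

lemma exists_isMinOn_phase {f g : ℝ → ℂ} (hf : MemLp f 2 volume) (hg : MemLp g 2 volume)
    {S : Set ℂ} (hS : IsCompact S) :
    ∃ τ : Circle, IsMinOn (fun τ' : Circle =>
      eLpNorm (fun z : ℂ => gabor g z - (τ' : ℂ) * gabor f z) 2 (volume.restrict S)) Set.univ τ := by
  obtain ⟨τ, -, hτ⟩ := isCompact_univ.exists_isMinOn Set.univ_nonempty
    (continuous_eLpNorm_phase hf hg hS).continuousOn
  exact ⟨τ, hτ⟩

lemma integral_eq_zero_of_eLpNorm_eq_zero {f g : ℝ → ℂ} (hf : MemLp f 2 volume)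
    (hg : MemLp g 2 volume) {S T : Set ℂ} (hT : T ⊆ S)
    (h : eLpNorm (fun z : ℂ => spectrogram f z - spectrogram g z) 2 (volume.restrict S) = 0) :
    ∫ z in T, |spectrogram f z - spectrogram g z| = 0 := by
  have hcd : Continuous fun z => spectrogram f z - spectrogram g z :=
    (continuous_spectrogram hf).sub (continuous_spectrogram hg)
  rw [eLpNorm_eq_zero_iff hcd.aestronglyMeasurable two_ne_zero] at h
  have h' := ae_restrict_of_ae_restrict_of_subset hT h
  refine integral_eq_zero_of_ae ?_
  filter_upwards [h'] with z hz
  rw [hz]; simp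

end GaborStability

end

/-! ### The theorem: degenerate cases, then the square root of the main bound. -/

theorem theorem2p9 :
    ∃ C : ℝ≥0, 0 < C ∧
      ∀ (f : ℝ → ℂ), MemLp f 2 (volume : Measure ℝ) →
      ∀ (ν : ℕ) (Q : Fin ν → Set ℂ), (∀ i, GaborStability.IsUnitSquare (Q i)) →
      ∀ (g : ℝ → ℂ), MemLp g 2 (volume : Measure ℝ) →
        ∃ τ : Circle,
          IsMinOn
            (fun τ' : Circle =>
              eLpNorm (fun z : ℂ => GaborStability.gabor g z - (τ' : ℂ) * GaborStability.gabor f z)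
                2 (volume.restrict (⋃ i, Q i)))
            Set.univ τ ∧
          eLpNorm (fun z : ℂ => GaborStability.gabor g z - (τ : ℂ) * GaborStability.gabor f z)
              2 (volume.restrict (⋃ i, Q i)) ≤
            (C : ℝ≥0∞) *
              (GaborStability.constK f g * GaborStability.constM f Q ^ (1 / 2 : ℝ)
                  * GaborStability.constL Q ^ (1 / 2 : ℝ)
                + (GaborStability.signalGraph f Q).algebraicConnectivity⁻¹
                  * GaborStability.constK f g * (ν : ℝ≥0∞) ^ (3 / 2 : ℝ)
                  * GaborStability.constL Q ^ (1 / 2 : ℝ)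
                + volume (⋃ i, Q i) ^ (1 / 2 : ℝ)) ^ (1 / 2 : ℝ) *
              eLpNorm
                (fun z : ℂ => GaborStability.spectrogram f z - GaborStability.spectrogram g z)
                2 (volume.restrict (⋃ i, Q i)) ^ (1 / 2 : ℝ) := by
  obtain ⟨C, hC, hmain⟩ := GaborStability.exists_main_bound
  -- `exists_main_bound` controls the squared norm, hence the square root of its constant.
  refine ⟨C.toNNReal ^ (1 / 2 : ℝ), NNReal.rpow_pos (by simpa using by linarith),
    fun f hf ν Q hQ g hg => ?_⟩
  have hΩ := GaborStability.isCompact_iUnion_unitSquare hQ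
  obtain ⟨τ, hτ⟩ := GaborStability.exists_isMinOn_phase hf hg hΩ
  refine ⟨τ, hτ, ?_⟩
  have hle : ∀ τ' : Circle,
      eLpNorm (fun z : ℂ => GaborStability.gabor g z - (τ : ℂ) * GaborStability.gabor f z)
        2 (volume.restrict (⋃ i, Q i))
      ≤ eLpNorm (fun z : ℂ => GaborStability.gabor g z - (τ' : ℂ) * GaborStability.gabor f z)
        2 (volume.restrict (⋃ i, Q i)) := fun τ' => hτ (Set.mem_univ τ')
  have hhalf : (0 : ℝ) < 1 / 2 := by norm_num
  have hC0 : ((C.toNNReal ^ (1 / 2 : ℝ) : ℝ≥0) : ℝ≥0∞) ≠ 0 := by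
    rw [ENNReal.coe_ne_zero]
    exact (NNReal.rpow_pos (by simpa using by linarith)).ne'
  rcases Nat.eq_zero_or_pos ν with rfl | hν
  · simp
  set ε := eLpNorm (fun z : ℂ => GaborStability.spectrogram f z - GaborStability.spectrogram g z)
    2 (volume.restrict (⋃ i, Q i)) with hε
  have hzero : ∀ v, (∫ z in Q v, |GaborStability.spectrogram f z - GaborStability.spectrogram g z|)
      = 0 → eLpNorm (fun z : ℂ => GaborStability.gabor g z - (τ : ℂ) * GaborStability.gabor f z)
        2 (volume.restrict (⋃ i, Q i)) = 0 := by
    intro v hv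
    obtain ⟨τ', hτ'⟩ := GaborStability.exists_gabor_eq_of_integral_eq_zero hf hg (hQ v) hv
    refine le_antisymm ((hle τ').trans (le_of_eq ?_)) zero_le
    simp [hτ']
  -- For `ε = 0` the right-hand side is 0 even if its coefficient is `∞`, so the distance must
  -- vanish exactly.
  rcases eq_or_ne ε 0 with hε0 | hε0
  · rw [hzero ⟨0, hν⟩ (GaborStability.integral_eq_zero_of_eLpNorm_eq_zero hf hg
      (Set.subset_iUnion Q _) hε0)]
    exact zero_le
  have hεhalf : ε ^ (1 / 2 : ℝ) ≠ 0 := by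
    rw [Ne, ENNReal.rpow_eq_zero_iff_of_pos hhalf]; exact hε0
  -- Nonvanishing of `K`, `L`, `ν` and `ε` ensures that `M = ∞` or `λ⁻¹ = ∞` makes the right-hand
  -- side infinite, instead of being cancelled by `0 · ∞ = 0`.
  have hK0 : GaborStability.constK f g ≠ 0 := by
    intro h
    have hK := (GaborStability.constK_ne_top_and_le hf hg).2
    rw [h, ENNReal.toReal_zero] at hK
    have h1 : ∀ z, GaborStability.spectrogram f z - GaborStability.spectrogram g z = 0 := fun z => by
      have h2 : 0 ≤ GaborStability.spectrogram f z := sq_nonneg _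
      have h3 : 0 ≤ GaborStability.spectrogram g z := sq_nonneg _
      have := hK z
      linarith
    apply hε0
    rw [hε]
    simp [h1]
  have hL0 : GaborStability.constL Q ≠ 0 := by
    intro h
    have h1 := GaborStability.sum_setIntegral_le_constL_mul hQ
      (continuous_const (y := (1 : ℝ))) fun _ => zero_le_one
    rw [h, ENNReal.toReal_zero, zero_mul] at h1
    simp only [setIntegral_const, Measure.real, (hQ _).volume_eq_one, ENNReal.toReal_one, smul_eq_mul,
      mul_one, Finset.sum_const, Finset.card_univ, Fintype.card_fin, nsmul_eq_mul] at h1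
    have : (0 : ℝ) < ν := by exact_mod_cast hν
    linarith
  have hLhalf : GaborStability.constL Q ^ (1 / 2 : ℝ) ≠ 0 := by
    rw [Ne, ENNReal.rpow_eq_zero_iff_of_pos hhalf]; exact hL0
  have hνpow : (ν : ℝ≥0∞) ^ (3 / 2 : ℝ) ≠ 0 := by
    rw [Ne, ENNReal.rpow_eq_zero_iff_of_pos (by norm_num)]
    exact_mod_cast hν.ne'
  by_cases hw : ∀ v, 0 < ∫ z in Q v, GaborStability.spectrogram f z
  swap
  · push Not at hw
    obtain ⟨v, hv⟩ := hw
    have hM : GaborStability.constM f Q = ∞ := by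
      rw [GaborStability.constM, ENNReal.sum_eq_top]
      refine ⟨v, Finset.mem_univ v, ?_⟩
      rw [GaborStability.eLpNorm_one_spectrogram hf (hQ v).isCompact, ENNReal.ofReal_of_nonpos hv]
      simp
    rw [hM, ENNReal.top_rpow_of_pos hhalf, ENNReal.mul_top hK0, ENNReal.top_mul hLhalf, top_add,
      top_add, ENNReal.top_rpow_of_pos hhalf, ENNReal.mul_top hC0, ENNReal.top_mul hεhalf]
    exact le_top
  rcases eq_or_ne (GaborStability.signalGraph f Q).algebraicConnectivity 0 with hconn | hconn
  · rw [hconn, ENNReal.inv_zero, ENNReal.top_mul hK0, ENNReal.top_mul hνpow, ENNReal.top_mul hLhalf,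
      add_top, top_add, ENNReal.top_rpow_of_pos hhalf, ENNReal.mul_top hC0, ENNReal.top_mul hεhalf]
    exact le_top
  obtain ⟨τ', hτ'⟩ := hmain f g hf hg ν Q hQ hw hconn
  have hcont : Continuous fun z : ℂ =>
      GaborStability.gabor g z - (τ' : ℂ) * GaborStability.gabor f z :=
    (GaborStability.continuous_gabor hg).sub
      (continuous_const.mul (GaborStability.continuous_gabor hf))
  refine (hle τ').trans ?_
  rw [GaborStability.eLpNorm_two_eq_sqrt hcont hΩ,
    GaborStability.ofReal_sqrt _ (integral_nonneg fun _ => sq_nonneg _)]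
  refine (ENNReal.rpow_le_rpow hτ' hhalf.le).trans ?_
  rw [ENNReal.mul_rpow_of_nonneg _ _ hhalf.le, ENNReal.mul_rpow_of_nonneg _ _ hhalf.le,
    ← mul_assoc, ENNReal.coe_rpow_of_nonneg _ hhalf.le]
  -- Only here does the volume term enter, as a nonnegative summand.
  exact mul_le_mul' (mul_le_mul' le_rfl (ENNReal.rpow_le_rpow le_self_add hhalf.le)) le_rfl
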